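/- Let $F$ be a field with $\operatorname{char} F\neq 2$, let $V$ be a $4$-dimensional vector space over $F$, let $h$ be a non-degenerate symmetric bilinear form on $V$, and let $b\colon\bigwedge^4V\to F$ be a linear isomorphism. On $W:=\bigwedge^2V$ let $\bigwedge^2h$ be the form with $\bigwedge^2h(v_1\wedge v_2,w_1\wedge w_2)=\det(h(v_i,w_j))$, put $\mathrm{Pf}(x,y):=b(x\wedge y)$, and let the Hodge operator $J\colon W\to W$ be defined by $\mathrm{Pf}(J(x),y)=\bigwedge^2h(x,y)$. For any basis $v_1,\dots,v_4$ of $V$ put $\delta:=\det(h(v_i,v_j))/b(v_1\wedge v_2\wedge v_3\wedge v_4)^2$ (this does not depend on the basis), and let $K$ be the $F$-algebra of all matrices $x_0+\boldsymbol{j}x_1:=\begin{pmatrix}x_0&\delta x_1\\x_1&x_0\end{pmatrix}$ with $x_0,x_1\in F$; it acts on $W$ from the right by $w(x_0+\boldsymbol{j}x_1)=wx_0+J(w)x_1$. Assume that $K$ is split, i.e., that $K$ contains divisors of zero. Then $b$ can be chosen such that $J^2=\mathrm{id}$ ("normalized"). Moreover, there is a quaternion algebra $H$ over $F$, with norm $N$,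 polarization $f_N(x,y)=N(x+y)-N(x)-N(y)$, and space of pure quaternions $\mathrm{Pu}\,H=\{x\in H\smallsetminus F\mid x^2\in F\}\cup\{0\}$, such that the following hold. (1) The form $h$ is similar to $f_N$. (2) The group of all similitudes of $f_N$ is generated by the standard involution of $H$ together with the left and right multiplications by invertible elements of $H$. Now let $b$ be any normalized isomorphism, put $z:=1+\boldsymbol{j}$ and $p:=\frac12z$, and define a symmetric bilinear form $g^\circ$ on $Wp=Wz$ by $g^\circ(Xz,Yz):=2\bigl(\bigwedge^2h(X,Y)+\mathrm{Pf}(X,Y)\bigr)$. Let $\mathrm{GO}^+(V,h)$ be the group of proper similitudes of $h$ (those $\lambda\in\mathrm{GL}(V)$ with $h(\lambda v,\lambda w)=c\,h(v,w)$ for all $v,w$ and $\det\lambda=c^2$, for some $c\in F^\times$). (3) $W=Wp\oplus W(1-p)$, both summands are invariant under $\mathrm{GO}^+(V,h)$, and there is a linear isomorphism $\Theta\colon Wp\to\mathrm{Pu}\,H$ which is a similitude from $g^\circ$ to the restriction of $f_N$ to $\mathrm{Pu}\,H$. Let $\eta^\circ_2(\lambda)$ denote the restriction of $\bigwedge^2\lambda$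 to $Wp$, regarded as a linear transformation of $\mathrm{Pu}\,H$ via $\Theta$. Then $\Theta$ can be chosen in (3) such that also the following hold. (4) There is a similitude $\varphi\colon V\to H$ from $h$ to $f_N$ such that for all invertible $a,c\in H$ the map $\lambda=\varphi^{-1}\circ(x\mapsto axc)\circ\varphi$ belongs to $\mathrm{GO}^+(V,h)$ and $\eta^\circ_2(\lambda)$ is the map $x\mapsto N(a)N(c)\,axa^{-1}$ of $\mathrm{Pu}\,H$. The representation of $\mathrm{GO}^+(V,h)$ on $W(1-p)$ is quasi-equivalent (i.e., equivalent up to an automorphism of the group) to the representation $\eta_2^\circ$ on $\mathrm{Pu}\,H$. (5) $\eta^\circ_2(\mathrm{GO}^+(V,h))=N(H^\times)\,\mathrm{SO}(\mathrm{Pu}\,H,f_N|_{\mathrm{Pu}\,H})$ and $\eta^\circ_2(\mathrm{SO}(V,h))=\mathrm{SO}(\mathrm{Pu}\,H,f_N|_{\mathrm{Pu}\,H})$. -/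

import Mathlib

open Module
open scoped Quaternion

noncomputable section

namespace Hodge

/-! ### Exterior powers, the induced form, the Pfaffian form and the Hodge operator -/

section Exterior

variable {F V : Type*} [Field F] [AddCommGroup V] [Module F V]

/-- The form `⋀^k h` on `⋀^k V`, with
`⋀^k h (v₁ ∧ ⋯ ∧ v_k, w₁ ∧ ⋯ ∧ w_k) = det (h (v_i, w_j))`. It is obtained by applying the functor
`⋀^k` to `h : V → V^∨` and using the natural map `⋀^k (V^∨) → (⋀^k V)^∨`. -/
def extForm (k : ℕ) (h : LinearMap.BilinForm F V) : LinearMap.BilinForm F (⋀[F]^k V) :=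
  exteriorPower.pairingDual F V k ∘ₗ exteriorPower.map k h

theorem extForm_ιMulti (k : ℕ) (h : LinearMap.BilinForm F V) (v w : Fin k → V) :
    extForm k h (exteriorPower.ιMulti F k v) (exteriorPower.ιMulti F k w) =
      Matrix.det (Matrix.of fun i j => h (v i) (w j)) := by
  rw [← Matrix.det_transpose]
  simp only [extForm, LinearMap.comp_apply, exteriorPower.map_apply_ιMulti]
  erw [exteriorPower.pairingDual_ιMulti_ιMulti]
  rfl

theorem bilin_ext {k : ℕ} {N : Type*} [AddCommGroup N] [Module F N]
    (f f' : ⋀[F]^k V →ₗ[F] ⋀[F]^k V →ₗ[F] N)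
    (H : ∀ v w : Fin k → V, f (exteriorPower.ιMulti F k v) (exteriorPower.ιMulti F k w) =
      f' (exteriorPower.ιMulti F k v) (exteriorPower.ιMulti F k w)) (x y : ⋀[F]^k V) :
    f x y = f' x y := by
  have key : f = f' := by
    apply LinearMap.ext_on (exteriorPower.ιMulti_span F k V)
    rintro _ ⟨v, rfl⟩
    apply LinearMap.ext_on (exteriorPower.ιMulti_span F k V)
    rintro _ ⟨w, rfl⟩
    exact H v w
  rw [key]

/-- The exterior product `⋀² V × ⋀² V → ⋀⁴ V`. -/
def wedge : ⋀[F]^2 V →ₗ[F] ⋀[F]^2 V →ₗ[F] ⋀[F]^4 V :=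
  LinearMap.mk₂ F
    (fun x y => ⟨(x : ExteriorAlgebra F V) * (y : ExteriorAlgebra F V), by
      have := Submodule.mul_mem_mul x.2 y.2
      rwa [← pow_add] at this⟩)
    (fun _ _ _ => Subtype.ext (add_mul _ _ _))
    (fun _ _ _ => Subtype.ext (smul_mul_assoc _ _ _))
    (fun _ _ _ => Subtype.ext (mul_add _ _ _))
    (fun _ _ _ => Subtype.ext (mul_smul_comm _ _ _))

theorem coe_wedge (x y : ⋀[F]^2 V) :
    (wedge x y : ExteriorAlgebra F V) = (x : ExteriorAlgebra F V) * (y : ExteriorAlgebra F V) :=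
  rfl

theorem wedge_ιMulti (v w : Fin 2 → V) :
    wedge (exteriorPower.ιMulti F 2 v) (exteriorPower.ιMulti F 2 w) =
      exteriorPower.ιMulti F 4 (Fin.append v w) :=
  Subtype.ext (ExteriorAlgebra.ιMulti_mul_ιMulti v w)

/-- The Pfaffian form `Pf (x, y) = b (x ∧ y)` on `⋀² V`. -/
def pf (b : ⋀[F]^4 V ≃ₗ[F] F) : LinearMap.BilinForm F (⋀[F]^2 V) :=
  wedge.compr₂ b.toLinearMap

theorem pf_apply (b : ⋀[F]^4 V ≃ₗ[F] F) (x y : ⋀[F]^2 V) : pf b x y = b (wedge x y) := rfl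

theorem pf_injective (hV : finrank F V = 4) (b : ⋀[F]^4 V ≃ₗ[F] F) :
    Function.Injective (pf b) := by
  have : FiniteDimensional F V := FiniteDimensional.of_finrank_pos (by omega)
  let e := finBasisOfFinrankEq F V hV
  let B := e.exteriorPower 2
  rw [injective_iff_map_eq_zero]
  intro x hx
  apply B.ext_elem
  intro s
  have hcard : ((s.val)ᶜ : Finset (Fin 4)).card = 2 := by
    have h1 : s.val.card = 2 := s.prop
    rw [Finset.card_compl, h1]; rfl
  let t : Set.powersetCard (Fin 4) 2 := ⟨(s.val)ᶜ, hcard⟩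
  have hdis : Disjoint s.val t.val := disjoint_compl_right
  have hval : ∀ u : Set.powersetCard (Fin 4) 2, u ≠ s → wedge (B u) (B t) = 0 := by
    intro u hu
    apply Subtype.ext
    rw [coe_wedge, exteriorPower.basis_apply, exteriorPower.basis_apply]
    apply ExteriorAlgebra.ιMulti_family_mul_of_not_disjoint
    intro hd
    apply hu
    apply Subtype.ext
    have hsub : u.val ⊆ s.val := by
      intro i hi
      by_contra his
      exact Finset.disjoint_left.mp hd hi (Finset.mem_compl.mpr his)
    apply Finset.eq_of_subset_of_card_le hsub
    have h1 : s.val.card = 2 := s.prop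
    have h2 : u.val.card = 2 := u.prop
    omega
  have hne : wedge (B s) (B t) ≠ 0 := by
    intro h0
    have h1 := congrArg (Subtype.val) h0
    rw [coe_wedge, exteriorPower.basis_apply, exteriorPower.basis_apply] at h1
    erw [ExteriorAlgebra.ιMulti_family_mul_of_disjoint F e s t hdis] at h1
    have h2 := (e.exteriorPower (2 + 2)).ne_zero (Set.powersetCard.disjUnion hdis)
    apply h2
    rw [exteriorPower.basis_apply]
    apply Subtype.ext
    rcases Int.units_eq_one_or (Set.powersetCard.permOfDisjoint hdis).sign with hs | hs
    · rw [hs, one_smul] at h1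
      exact h1
    · rw [hs, Units.neg_smul, one_smul] at h1
      exact neg_eq_zero.mp h1
  have hz : wedge x (B t) = 0 := by
    apply b.injective
    rw [map_zero, ← pf_apply, hx]; rfl
  rw [← B.sum_repr x, map_sum, LinearMap.sum_apply, Finset.sum_eq_single s] at hz
  · rw [map_smul, LinearMap.smul_apply, smul_eq_zero] at hz
    simpa using hz.resolve_right hne
  · intro u _ hu
    rw [map_smul, LinearMap.smul_apply, hval u hu, smul_zero]
  · intro hs
    exact absurd (Finset.mem_univ s) hs

/-- The Pfaffian form as an isomorphism of `⋀² V` onto its dual space. -/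
def pfEquiv (hV : finrank F V = 4) (b : ⋀[F]^4 V ≃ₗ[F] F) :
    ⋀[F]^2 V ≃ₗ[F] Dual F (⋀[F]^2 V) :=
  haveI : FiniteDimensional F V := FiniteDimensional.of_finrank_pos (by omega)
  LinearEquiv.ofBijective (pf b) ⟨pf_injective hV b,
    (LinearMap.injective_iff_surjective_of_finrank_eq_finrank
      (Subspace.dual_finrank_eq (K := F) (V := ⋀[F]^2 V)).symm).mp (pf_injective hV b)⟩

/-- The Hodge operator `J = Pf⁻¹ ∘ ⋀² h` on `⋀² V`. -/
def hodge (hV : finrank F V = 4) (h : LinearMap.BilinForm F V) (b : ⋀[F]^4 V ≃ₗ[F] F) :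
    ⋀[F]^2 V →ₗ[F] ⋀[F]^2 V :=
  (pfEquiv hV b).symm.toLinearMap ∘ₗ extForm 2 h

theorem pf_hodge (hV : finrank F V = 4) (h : LinearMap.BilinForm F V) (b : ⋀[F]^4 V ≃ₗ[F] F)
    (x y : ⋀[F]^2 V) : pf b (hodge hV h b x) y = extForm 2 h x y :=
  LinearMap.congr_fun ((pfEquiv hV b).apply_symm_apply (extForm 2 h x)) y

/-- The scalar `δ = det H / b (v₁ ∧ v₂ ∧ v₃ ∧ v₄)²`, where `H = (h (v_i, v_j))` is the Gram matrix
for any basis `v` of `V`; see `gram_det_eq`. -/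
def delta (h : LinearMap.BilinForm F V) (b : ⋀[F]^4 V ≃ₗ[F] F) : F :=
  extForm 4 h (b.symm 1) (b.symm 1)

theorem gram_det_eq (h : LinearMap.BilinForm F V) (b : ⋀[F]^4 V ≃ₗ[F] F) (v : Fin 4 → V) :
    Matrix.det (Matrix.of fun i j => h (v i) (v j)) =
      b (exteriorPower.ιMulti F 4 v) ^ 2 * delta h b := by
  have hv : exteriorPower.ιMulti F 4 v = b (exteriorPower.ιMulti F 4 v) • b.symm 1 := by
    apply b.injective
    simp
  rw [← extForm_ιMulti, delta]
  conv_lhs => rw [hv]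
  simp only [map_smul, LinearMap.smul_apply, smul_eq_mul]
  ring

end Exterior

/-! ### The algebra `K`, its action on `⋀² V`, and the forms `g` and `g°` -/

section AlgebraK

variable {F V : Type*} [Field F] [AddCommGroup V] [Module F V]

/-- The matrix `x₀ + j x₁` with `j² = d`. -/
def kMat (d x₀ x₁ : F) : Matrix (Fin 2) (Fin 2) F := !![x₀, d * x₁; x₁, x₀]

/-- The algebra `K` of all matrices `!![x₀, δ x₁; x₁, x₀]`. -/
def algK (h : LinearMap.BilinForm F V) (b : ⋀[F]^4 V ≃ₗ[F] F) :
    Subalgebra F (Matrix (Fin 2) (Fin 2) F) where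
  carrier := {M | ∃ x₀ x₁ : F, M = kMat (delta h b) x₀ x₁}
  mul_mem' := by
    rintro _ _ ⟨x, y, rfl⟩ ⟨x', y', rfl⟩
    refine ⟨x * x' + delta h b * y * y', y * x' + x * y', ?_⟩
    ext i k
    fin_cases i <;> fin_cases k <;> simp [kMat, Matrix.mul_apply, Fin.sum_univ_two] <;> ring
  add_mem' := by
    rintro _ _ ⟨x, y, rfl⟩ ⟨x', y', rfl⟩
    refine ⟨x + x', y + y', ?_⟩
    ext i k
    fin_cases i <;> fin_cases k <;> simp [kMat]
    ring
  algebraMap_mem' := by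
    intro r
    refine ⟨r, 0, ?_⟩
    ext i k
    fin_cases i <;> fin_cases k <;> simp [kMat, Matrix.algebraMap_matrix_apply]

/-- `K` is split if it contains divisors of zero. -/
def IsSplit (h : LinearMap.BilinForm F V) (b : ⋀[F]^4 V ≃ₗ[F] F) : Prop :=
  ∃ x y : algK h b, x ≠ 0 ∧ y ≠ 0 ∧ x * y = 0

/-- The element `x₀ + j x₁` of `K`. -/
def kMk (h : LinearMap.BilinForm F V) (b : ⋀[F]^4 V ≃ₗ[F] F) (x₀ x₁ : F) : algK h b :=
  ⟨kMat (delta h b) x₀ x₁, x₀, x₁, rfl⟩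

/-- The element `j` of `K`. -/
def kj (h : LinearMap.BilinForm F V) (b : ⋀[F]^4 V ≃ₗ[F] F) : algK h b := kMk h b 0 1

/-- The element `z = 1 + j` of `K`. -/
def kz (h : LinearMap.BilinForm F V) (b : ⋀[F]^4 V ≃ₗ[F] F) : algK h b := 1 + kj h b

/-- The element `p = z / 2` of `K`. -/
def kp (h : LinearMap.BilinForm F V) (b : ⋀[F]^4 V ≃ₗ[F] F) : algK h b := (2 : F)⁻¹ • kz h b

/-- The right action of `x₀ + j x₁ ∈ K` on `W = ⋀² V`, where `j` acts as the Hodge operator. -/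
def act (hV : finrank F V = 4) (h : LinearMap.BilinForm F V) (b : ⋀[F]^4 V ≃ₗ[F] F)
    (x : algK h b) : ⋀[F]^2 V →ₗ[F] ⋀[F]^2 V :=
  x.1 0 0 • LinearMap.id + x.1 1 0 • hodge hV h b

/-- The subspace `W x` of `W = ⋀² V`, for `x ∈ K`. -/
def Wsub (hV : finrank F V = 4) (h : LinearMap.BilinForm F V) (b : ⋀[F]^4 V ≃ₗ[F] F)
    (x : algK h b) : Submodule F (⋀[F]^2 V) :=
  LinearMap.range (act hV h b x)

/-- The form `g (u, v) = ⋀² h (u, v) + j Pf (u, v)` on `W` with values in `K`. -/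
def gForm (h : LinearMap.BilinForm F V) (b : ⋀[F]^4 V ≃ₗ[F] F) (u v : ⋀[F]^2 V) : algK h b :=
  kMk h b (extForm 2 h u v) (pf b u v)

/-- The map `K → F`, `x + j y ↦ (x + y) + (x + y)`. -/
def rMap (h : LinearMap.BilinForm F V) (b : ⋀[F]^4 V ≃ₗ[F] F) (x : algK h b) : F :=
  (x.1 0 0 + x.1 1 0) + (x.1 0 0 + x.1 1 0)

/-- The form `g°` on `W p = W z`, given by `g° (X z, Y z) = r (g (X, Y))`. If `b` is normalized
(`J² = id`) then `u = (u / 2) z` for each `u ∈ W z`; this gives the values used here.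
See `gCirc_act` for the defining property. -/
def gCirc (hV : finrank F V = 4) (h : LinearMap.BilinForm F V) (b : ⋀[F]^4 V ≃ₗ[F] F) :
    LinearMap.BilinForm F (Wsub hV h b (kp h b)) :=
  LinearMap.mk₂ F
    (fun u v => rMap h b (gForm h b ((2 : F)⁻¹ • (u : ⋀[F]^2 V)) ((2 : F)⁻¹ • (v : ⋀[F]^2 V))))
    (fun _ _ _ => by simp [rMap, gForm, kMk, kMat]; ring)
    (fun _ _ _ => by simp [rMap, gForm, kMk, kMat]; ring)
    (fun _ _ _ => by simp [rMap, gForm, kMk, kMat]; ring)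
    (fun _ _ _ => by simp [rMap, gForm, kMk, kMat]; ring)

/-- `b` is normalized if `J² = id` (equivalently, `δ = 1`). -/
def IsNormalized (hV : finrank F V = 4) (h : LinearMap.BilinForm F V)
    (b : ⋀[F]^4 V ≃ₗ[F] F) : Prop :=
  hodge hV h b ∘ₗ hodge hV h b = LinearMap.id

theorem act_kz (hV : finrank F V = 4) (h : LinearMap.BilinForm F V) (b : ⋀[F]^4 V ≃ₗ[F] F)
    (X : ⋀[F]^2 V) : act hV h b (kz h b) X = X + hodge hV h b X := by
  simp [act, kz, kj, kMk, kMat]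

theorem act_kp (hV : finrank F V = 4) (h : LinearMap.BilinForm F V) (b : ⋀[F]^4 V ≃ₗ[F] F)
    (X : ⋀[F]^2 V) : act hV h b (kp h b) X = (2 : F)⁻¹ • (X + hodge hV h b X) := by
  simp [act, kp, kz, kj, kMk, kMat]

theorem act_kz_mem [NeZero (2 : F)] (hV : finrank F V = 4) (h : LinearMap.BilinForm F V)
    (b : ⋀[F]^4 V ≃ₗ[F] F) (X : ⋀[F]^2 V) :
    act hV h b (kz h b) X ∈ Wsub hV h b (kp h b) :=
  ⟨(2 : F) • X, by
    rw [act_kz, act_kp, map_smul, ← smul_add, smul_smul, inv_mul_cancel₀ (NeZero.ne _), one_smul]⟩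

theorem extForm_symm (k : ℕ) (h : LinearMap.BilinForm F V) (hs : h.IsSymm) (x y : ⋀[F]^k V) :
    extForm k h x y = extForm k h y x := by
  refine bilin_ext (extForm k h) (LinearMap.flip (extForm k h)) (fun v w => ?_) x y
  rw [LinearMap.flip_apply, extForm_ιMulti, extForm_ιMulti, ← Matrix.det_transpose]
  congr 1
  ext i j
  exact hs.eq _ _

theorem wedge_comm (x y : ⋀[F]^2 V) : wedge x y = wedge y x := by
  refine bilin_ext wedge wedge.flip (fun v w => ?_) x y
  rw [LinearMap.flip_apply, wedge_ιMulti, wedge_ιMulti]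
  let τ : Equiv.Perm (Fin 4) := Equiv.swap 0 2 * Equiv.swap 1 3
  have h1 : Fin.append w v = Fin.append v w ∘ τ := by
    funext i
    fin_cases i <;> rfl
  have h2 : Equiv.Perm.sign τ = 1 := by decide
  rw [h1, AlternatingMap.map_perm, h2, one_smul]

/-- The defining property of `g°`. -/
theorem gCirc_act [NeZero (2 : F)] (hV : finrank F V = 4) (h : LinearMap.BilinForm F V)
    (hs : h.IsSymm) (b : ⋀[F]^4 V ≃ₗ[F] F) (hb : IsNormalized hV h b) (X Y : ⋀[F]^2 V) :
    gCirc hV h b ⟨act hV h b (kz h b) X, act_kz_mem hV h b X⟩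
      ⟨act hV h b (kz h b) Y, act_kz_mem hV h b Y⟩ = rMap h b (gForm h b X Y) := by
  have hJ : ∀ x, hodge hV h b (hodge hV h b x) = x := fun x => LinearMap.congr_fun hb x
  have e1 : ∀ x y, pf b x y = extForm 2 h (hodge hV h b x) y := fun x y => by
    rw [← pf_hodge hV, hJ]
  have e2 : ∀ x y, extForm 2 h (hodge hV h b x) y = extForm 2 h x (hodge hV h b y) :=
    fun x y => by
      rw [← e1, pf_apply, wedge_comm, ← pf_apply, e1, extForm_symm 2 h hs]
  have h2 : (2 : F) ≠ 0 := NeZero.ne _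
  simp only [gCirc, LinearMap.mk₂_apply, rMap, gForm, kMk, kMat, act_kz, map_smul, map_add,
    LinearMap.smul_apply, LinearMap.add_apply, smul_eq_mul, e1, hJ, Matrix.of_apply,
    Matrix.cons_val_zero, Matrix.cons_val_one, Matrix.cons_val', Matrix.cons_val_fin_one]
  rw [← e2 X Y, ← e2 (hodge hV h b X) Y, hJ]
  field_simp
  ring

end AlgebraK

/-! ### Groups of similitudes -/

section Similitudes

variable {F : Type*} [Field F]
variable {V : Type*} [AddCommMonoid V] [Module F V]
variable {U : Type*} [AddCommMonoid U] [Module F U]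

/-- `e` is a similitude of `(V, f)` onto `(U, f')`. -/
def IsSimilitude (f : LinearMap.BilinForm F V) (f' : LinearMap.BilinForm F U)
    (e : V ≃ₗ[F] U) : Prop :=
  ∃ c : F, c ≠ 0 ∧ ∀ x y, f' (e x) (e y) = c * f x y

/-- Conjugation by an isomorphism `e : V → U`, as an isomorphism `GL(V) → GL(U)`. -/
def transport (e : V ≃ₗ[F] U) : (V ≃ₗ[F] V) ≃* (U ≃ₗ[F] U) where
  toFun l := e.symm.trans (l.trans e)
  invFun m := e.trans (m.trans e.symm)
  left_inv l := by ext; simp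
  right_inv m := by ext; simp
  map_mul' l m := by ext; simp

/-- Two representations of a group `G` are quasi-equivalent if they are equivalent up to
an automorphism of `G`. -/
def QuasiEquivalent {G : Type*} [Group G] (ρ : G →* (V ≃ₗ[F] V)) (ρ' : G →* (U ≃ₗ[F] U)) : Prop :=
  ∃ (θ : G ≃* G) (e : V ≃ₗ[F] U), ∀ (x : G) (v : V), e (ρ x v) = ρ' (θ x) (e v)

end Similitudes

section Groups

variable {F V : Type*} [Field F] [AddCommGroup V] [Module F V]

/-- The group `GO(V, f)` of similitudes. -/
def GO (f : LinearMap.BilinForm F V) : Subgroup (V ≃ₗ[F] V) where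
  carrier := {l | IsSimilitude f f l}
  one_mem' := ⟨1, one_ne_zero, fun x y => by simp⟩
  mul_mem' := by
    rintro l m ⟨c, hc, hl⟩ ⟨d, hd, hm⟩
    exact ⟨c * d, mul_ne_zero hc hd, fun x y => by simp [hl, hm, mul_assoc]⟩
  inv_mem' := by
    rintro l ⟨c, hc, hl⟩
    refine ⟨c⁻¹, inv_ne_zero hc, fun x y => ?_⟩
    have hx : l (l⁻¹ x) = x := l.apply_symm_apply x
    have hy : l (l⁻¹ y) = y := l.apply_symm_apply y
    have := hl (l⁻¹ x) (l⁻¹ y)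
    rw [hx, hy] at this
    rw [this, inv_mul_cancel_left₀ hc]

/-- The group of proper similitudes of a `4`-dimensional space: similitudes with
`det l = c²`, where `c` is the multiplier of `l`. -/
def GOplus (f : LinearMap.BilinForm F V) : Subgroup (V ≃ₗ[F] V) where
  carrier := {l | ∃ c : F, c ≠ 0 ∧ (∀ x y, f (l x) (l y) = c * f x y) ∧
    LinearMap.det (l : V →ₗ[F] V) = c ^ 2}
  one_mem' := ⟨1, one_ne_zero, fun x y => by simp, by
    rw [one_pow]; exact LinearMap.det_id⟩
  mul_mem' := by
    rintro l m ⟨c, hc, hl, hl'⟩ ⟨d, hd, hm, hm'⟩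
    refine ⟨c * d, mul_ne_zero hc hd, fun x y => by simp [hl, hm, mul_assoc], ?_⟩
    have : ((l * m : V ≃ₗ[F] V) : V →ₗ[F] V) = (l : V →ₗ[F] V) ∘ₗ (m : V →ₗ[F] V) := rfl
    rw [this, LinearMap.det_comp, hl', hm', mul_pow]
  inv_mem' := by
    rintro l ⟨c, hc, hl, hl'⟩
    refine ⟨c⁻¹, inv_ne_zero hc, fun x y => ?_, ?_⟩
    · have hx : l (l⁻¹ x) = x := l.apply_symm_apply x
      have hy : l (l⁻¹ y) = y := l.apply_symm_apply y
      have := hl (l⁻¹ x) (l⁻¹ y)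
      rw [hx, hy] at this
      rw [this, inv_mul_cancel_left₀ hc]
    · have h1 : LinearMap.det (l : V →ₗ[F] V) * LinearMap.det ((l⁻¹ : V ≃ₗ[F] V) : V →ₗ[F] V)
          = 1 := by
        rw [← LinearMap.det_comp]
        have : (l : V →ₗ[F] V) ∘ₗ ((l⁻¹ : V ≃ₗ[F] V) : V →ₗ[F] V) = LinearMap.id := by
          ext x
          exact l.apply_symm_apply x
        rw [this, LinearMap.det_id]
      rw [hl'] at h1
      rw [inv_pow]
      exact eq_inv_of_mul_eq_one_right h1

/-- The special orthogonal group `SO(V, f)`. -/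
def SO (f : LinearMap.BilinForm F V) : Subgroup (V ≃ₗ[F] V) where
  carrier := {l | (∀ x y, f (l x) (l y) = f x y) ∧ LinearEquiv.det l = 1}
  one_mem' := ⟨fun x y => by simp, map_one _⟩
  mul_mem' := by
    rintro l m ⟨hl, hl'⟩ ⟨hm, hm'⟩
    exact ⟨fun x y => by simp [hl, hm], by rw [map_mul, hl', hm', one_mul]⟩
  inv_mem' := by
    rintro l ⟨hl, hl'⟩
    refine ⟨fun x y => ?_, by rw [map_inv, hl', inv_one]⟩
    have hx : l (l⁻¹ x) = x := l.apply_symm_apply x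
    have hy : l (l⁻¹ y) = y := l.apply_symm_apply y
    have := hl (l⁻¹ x) (l⁻¹ y)
    rwa [hx, hy, eq_comm] at this

theorem SO_le_GOplus (f : LinearMap.BilinForm F V) : SO f ≤ GOplus f := by
  rintro l ⟨hl, hl'⟩
  refine ⟨1, one_ne_zero, fun x y => by rw [hl, one_mul], ?_⟩
  rw [one_pow, ← LinearEquiv.coe_det, hl', Units.val_one]

end Groups

/-! ### The representations on `W x` -/

section Eta

variable {F V : Type*} [Field F] [AddCommGroup V] [Module F V]

theorem map_four (hV : finrank F V = 4) (l : V →ₗ[F] V) (ω : ⋀[F]^4 V) (b : ⋀[F]^4 V ≃ₗ[F] F) :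
    b (exteriorPower.map 4 l ω) = LinearMap.det l * b ω := by
  have : FiniteDimensional F V := FiniteDimensional.of_finrank_pos (by omega)
  let e := finBasisOfFinrankEq F V hV
  let f : V [⋀^Fin 4]→ₗ[F] F :=
    (b : ⋀[F]^4 V →ₗ[F] F).compAlternatingMap (exteriorPower.ιMulti F 4)
  have hf := f.eq_smul_basis_det e
  have key : (b : ⋀[F]^4 V →ₗ[F] F) ∘ₗ exteriorPower.map 4 l =
      LinearMap.det l • (b : ⋀[F]^4 V →ₗ[F] F) := by
    apply exteriorPower.linearMap_ext
    ext v
    have h1 : f (l ∘ v) = LinearMap.det l * f v := by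
      rw [hf]
      simp only [AlternatingMap.smul_apply, Basis.det_comp, smul_eq_mul]
      ring
    simpa [f, exteriorPower.map_apply_ιMulti] using h1
  exact LinearMap.congr_fun key ω

theorem map_wedge (l : V →ₗ[F] V) (x y : ⋀[F]^2 V) :
    exteriorPower.map 4 l (wedge x y) =
      wedge (exteriorPower.map 2 l x) (exteriorPower.map 2 l y) := by
  refine bilin_ext (wedge.compr₂ (exteriorPower.map 4 l))
    (wedge.compl₁₂ (exteriorPower.map 2 l) (exteriorPower.map 2 l)) (fun v w => ?_) x y
  simp only [LinearMap.compr₂_apply, LinearMap.compl₁₂_apply, exteriorPower.map_apply_ιMulti,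
    wedge_ιMulti]
  congr 1
  funext i
  fin_cases i <;> rfl

theorem extForm_map (h : LinearMap.BilinForm F V) (l : V →ₗ[F] V) (c : F)
    (hl : ∀ v w, h (l v) (l w) = c * h v w) (x y : ⋀[F]^2 V) :
    extForm 2 h (exteriorPower.map 2 l x) (exteriorPower.map 2 l y) = c ^ 2 * extForm 2 h x y := by
  refine bilin_ext ((extForm 2 h).compl₁₂ (exteriorPower.map 2 l) (exteriorPower.map 2 l))
    (c ^ 2 • extForm 2 h) (fun v w => ?_) x y
  simp only [LinearMap.compl₁₂_apply, LinearMap.smul_apply, exteriorPower.map_apply_ιMulti,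
    extForm_ιMulti, smul_eq_mul]
  simp [Matrix.det_fin_two, hl]
  ring

/-- Proper similitudes commute with the Hodge operator. -/
theorem map_hodge (hV : finrank F V = 4) (h : LinearMap.BilinForm F V) (b : ⋀[F]^4 V ≃ₗ[F] F)
    {l : V ≃ₗ[F] V} (hl : l ∈ GOplus h) (x : ⋀[F]^2 V) :
    exteriorPower.map 2 (l : V →ₗ[F] V) (hodge hV h b x) =
      hodge hV h b (exteriorPower.map 2 (l : V →ₗ[F] V) x) := by
  obtain ⟨c, hc, hl, hd⟩ := hl
  apply pf_injective hV b
  refine LinearMap.ext fun y => ?_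
  obtain ⟨y, rfl⟩ := exteriorPower.map_surjective (n := 2) (f := (l : V →ₗ[F] V)) l.surjective y
  rw [pf_hodge, extForm_map h _ c hl, pf_apply, ← map_wedge, map_four hV, hd, ← pf_apply, pf_hodge]

theorem map_act (hV : finrank F V = 4) (h : LinearMap.BilinForm F V) (b : ⋀[F]^4 V ≃ₗ[F] F)
    (x : algK h b) {l : V ≃ₗ[F] V} (hl : l ∈ GOplus h) (w : ⋀[F]^2 V) :
    exteriorPower.map 2 (l : V →ₗ[F] V) (act hV h b x w) =
      act hV h b x (exteriorPower.map 2 (l : V →ₗ[F] V) w) := by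
  simp [act, map_hodge hV h b hl]

theorem map_mem_Wsub (hV : finrank F V = 4) (h : LinearMap.BilinForm F V)
    (b : ⋀[F]^4 V ≃ₗ[F] F) (x : algK h b) {l : V ≃ₗ[F] V} (hl : l ∈ GOplus h) {w : ⋀[F]^2 V}
    (hw : w ∈ Wsub hV h b x) :
    exteriorPower.map 2 (l : V →ₗ[F] V) w ∈ Wsub hV h b x := by
  obtain ⟨w, rfl⟩ := hw
  exact ⟨_, (map_act hV h b x hl w).symm⟩

theorem map_mul_apply (l m : V ≃ₗ[F] V) (w : ⋀[F]^2 V) :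
    exteriorPower.map 2 ((l * m : V ≃ₗ[F] V) : V →ₗ[F] V) w =
      exteriorPower.map 2 (l : V →ₗ[F] V) (exteriorPower.map 2 (m : V →ₗ[F] V) w) := by
  rw [← LinearMap.comp_apply, ← exteriorPower.map_comp]
  rfl

theorem map_one_apply (w : ⋀[F]^2 V) :
    exteriorPower.map 2 ((1 : V ≃ₗ[F] V) : V →ₗ[F] V) w = w := by
  have : ((1 : V ≃ₗ[F] V) : V →ₗ[F] V) = LinearMap.id := rfl
  rw [this, exteriorPower.map_id, LinearMap.id_apply]

/-- The action `l ↦ (⋀² l)|_{W x}` of the group of proper similitudes of `h` on `W x`.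
For `x = p` this is `η°`. -/
def eta (hV : finrank F V = 4) (h : LinearMap.BilinForm F V) (b : ⋀[F]^4 V ≃ₗ[F] F)
    (x : algK h b) : GOplus h →* (Wsub hV h b x ≃ₗ[F] Wsub hV h b x) where
  toFun l :=
    { toFun := fun w => ⟨exteriorPower.map 2 (l.1 : V →ₗ[F] V) w.1, map_mem_Wsub hV h b x l.2 w.2⟩
      map_add' := fun _ _ => Subtype.ext (map_add _ _ _)
      map_smul' := fun _ _ => Subtype.ext (map_smul _ _ _)
      invFun := fun w =>
        ⟨exteriorPower.map 2 ((l⁻¹).1 : V →ₗ[F] V) w.1, map_mem_Wsub hV h b x (l⁻¹).2 w.2⟩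
      left_inv := fun w => Subtype.ext (by
        change exteriorPower.map 2 ((l.1⁻¹ : V ≃ₗ[F] V) : V →ₗ[F] V)
          (exteriorPower.map 2 (l.1 : V →ₗ[F] V) w.1) = w.1
        rw [← map_mul_apply, inv_mul_cancel, map_one_apply])
      right_inv := fun w => Subtype.ext (by
        change exteriorPower.map 2 (l.1 : V →ₗ[F] V)
          (exteriorPower.map 2 ((l.1⁻¹ : V ≃ₗ[F] V) : V →ₗ[F] V) w.1) = w.1
        rw [← map_mul_apply, mul_inv_cancel, map_one_apply]) }
  map_one' := by
    refine LinearEquiv.ext fun w => Subtype.ext ?_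
    exact map_one_apply w.1
  map_mul' l m := by
    refine LinearEquiv.ext fun w => Subtype.ext ?_
    exact map_mul_apply l.1 m.1 w.1

end Eta

/-! ### Quaternion algebras -/

section Quaternions

variable {F : Type*} [Field F]

/-- The norm `N (x) = x * star x` of the quaternion algebra with `i² = r`, `j² = s`. -/
def quatNorm (r s : F) : QuadraticForm F ℍ[F,r,s] :=
  LinearMap.BilinMap.toQuadraticMap
    (LinearMap.mk₂ F (fun x y : ℍ[F,r,s] => (x * star y).re)
      (fun _ _ _ => by simp; ring) (fun _ _ _ => by simp)
      (fun _ _ _ => by simp; ring) (fun _ _ _ => by simp))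

theorem quatNorm_apply (r s : F) (x : ℍ[F,r,s]) :
    algebraMap F ℍ[F,r,s] (quatNorm r s x) = x * star x :=
  (QuaternionAlgebra.mul_star_eq_coe x).symm

/-- The polarization `f_N (x, y) = N (x + y) - N (x) - N (y)` of the norm. -/
def quatPolar (r s : F) : LinearMap.BilinForm F ℍ[F,r,s] := (quatNorm r s).polarBilin

theorem pure_iff [NeZero (2 : F)] (r s : F) (x : ℍ[F,r,s]) :
    ((x ∉ Set.range (algebraMap F ℍ[F,r,s]) ∧ x ^ 2 ∈ Set.range (algebraMap F ℍ[F,r,s])) ∨ x = 0) ↔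
      x.re = 0 := by
  have h2 : (2 : F) ≠ 0 := NeZero.ne _
  constructor
  · rintro (⟨hx, y, hy⟩ | rfl)
    · by_contra hre
      apply hx
      have hI := congrArg QuaternionAlgebra.imI hy
      have hJ := congrArg QuaternionAlgebra.imJ hy
      have hK := congrArg QuaternionAlgebra.imK hy
      simp [sq] at hI hJ hK
      have k : (2 * x.re) ≠ 0 := mul_ne_zero h2 hre
      refine ⟨x.re, ?_⟩
      ext
      · simp
      · have : (2 * x.re) * x.imI = 0 := by linear_combination -hI
        simp [(mul_eq_zero.mp this).resolve_left k]
      · have : (2 * x.re) * x.imJ = 0 := by linear_combination -hJ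
        simp [(mul_eq_zero.mp this).resolve_left k]
      · have : (2 * x.re) * x.imK = 0 := by linear_combination -hK
        simp [(mul_eq_zero.mp this).resolve_left k]
    · simp
  · intro hre
    by_cases h0 : x = 0
    · exact Or.inr h0
    · refine Or.inl ⟨?_, (x * x).re, ?_⟩
      · rintro ⟨y, rfl⟩
        apply h0
        have : y = 0 := by simpa using hre
        rw [this, map_zero]
      · ext <;> simp [sq, hre] <;> ring

/-- The space `Pu H = {x ∈ H ∖ F | x² ∈ F} ∪ {0}` of pure quaternions. -/
def Pu [NeZero (2 : F)] (r s : F) : Submodule F ℍ[F,r,s] where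
  carrier := {x | (x ∉ Set.range (algebraMap F ℍ[F,r,s]) ∧
    x ^ 2 ∈ Set.range (algebraMap F ℍ[F,r,s])) ∨ x = 0}
  zero_mem' := Or.inr rfl
  add_mem' {x y} hx hy := by
    have hx' := (pure_iff r s x).mp hx
    have hy' := (pure_iff r s y).mp hy
    exact (pure_iff r s _).mpr (by simp [hx', hy'])
  smul_mem' c x hx := by
    have hx' := (pure_iff r s x).mp hx
    exact (pure_iff r s _).mpr (by simp [hx'])

/-- The restriction of `f_N` to the space of pure quaternions. -/
def puPolar [NeZero (2 : F)] (r s : F) : LinearMap.BilinForm F (Pu r s) :=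
  (quatPolar r s).restrict (Pu r s)

/-- The map `x ↦ a x c` on the quaternion algebra, for invertible elements `a` and `c`. -/
def mulLR {r s : F} (a c : (ℍ[F,r,s])ˣ) : ℍ[F,r,s] ≃ₗ[F] ℍ[F,r,s] where
  toFun x := a * x * c
  invFun x := (a⁻¹ : (ℍ[F,r,s])ˣ) * x * (c⁻¹ : (ℍ[F,r,s])ˣ)
  map_add' x y := by rw [mul_add, add_mul]
  map_smul' t x := by simp
  left_inv x := by simp [mul_assoc]
  right_inv x := by simp [mul_assoc]

/-- The standard involution of the quaternion algebra as a linear map. -/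
def conjEquiv (r s : F) : ℍ[F,r,s] ≃ₗ[F] ℍ[F,r,s] where
  toFun x := star x
  invFun x := star x
  map_add' := star_add
  map_smul' t x := by ext <;> simp
  left_inv := star_star
  right_inv := star_star

end Quaternions

end Hodge

end

/-! If `K` has zero divisors, then `δ` is a square. An orthogonal basis of `V` then shows that `h`
is, up to a scalar, the norm form of a quaternion algebra `H`, so there is a similitude `φ : V → H`.

The core is the map `pureWedge φ`, `x ∧ y ↦ φ x * star (φ y) - φ y * star (φ x)`, from `⋀² V` to `Pu
H`, together with its companion for `φ̄ = star ∘ φ`. By `quatPolar_wedge`, pulling `f_N` back along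
these two maps gives `2c² ⋀² h + κ Pf` and `2c² ⋀² h - κ Pf`, because the involution has determinant
`-1` (`exists_puPolar_pureWedge`). As `Pf` is non-degenerate and `6 = 3 + 3`, the two maps together
identify `⋀² V` with `Pu H × Pu H`, and `J` becomes a pair of opposite nonzero scalars. Rescaling
`b` makes them `1` and `-1`. For a normalized `b` they are `±1` already, and replacing `φ` by `φ̄`
if necessary puts `1` first (`exists_isAdapted`). Now `W p` and `W (1 - p)` are the kernels of the
second and of the first map, and `Θ` is the restriction of `pureWedge φ` to `W p`.

Every similitude of the norm form is `x ↦ a x c` or `x ↦ a (star x) c` (`similitude_eq`): divide by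
the image of `1`; an isometry fixing `1` is an automorphism or an antiautomorphism, and
automorphisms are inner. The proper ones are those without `star`, since `det` is the factor by
which `Pf` is scaled and `star` reverses its sign. Finally, `(a x c) * star (a y c) = N a * N c * a
(x * star y) a⁻¹` yields the formula for `η°`. Its images follow because the rotations of `Pu H` are
exactly the conjugations (`exists_puConj`), and the improper isometry `φ⁻¹ ∘ star ∘ φ` interchanges
the two summands of `W`. -/

noncomputable section

namespace Hodge

/-! ### Norm, units and inner automorphisms of quaternion algebras, split ones included. -/

section QuaternionLemmas

variable {F : Type*} [Field F] {r s : F}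

theorem quatNorm_eq (x : ℍ[F,r,s]) : quatNorm r s x =
    x.re * x.re - r * (x.imI * x.imI) - s * (x.imJ * x.imJ) + r * s * (x.imK * x.imK) := by
  change (x * star x).re = _
  simp
  ring

theorem quatPolar_eq (x y : ℍ[F,r,s]) : quatPolar r s x y =
    2 * (x.re * y.re - r * (x.imI * y.imI) - s * (x.imJ * y.imJ) + r * s * (x.imK * y.imK)) := by
  change quatNorm r s (x + y) - quatNorm r s x - quatNorm r s y = _
  simp only [quatNorm_eq, QuaternionAlgebra.re_add, QuaternionAlgebra.imI_add,
    QuaternionAlgebra.imJ_add, QuaternionAlgebra.imK_add]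
  ring

theorem quatPolar_self (x : ℍ[F,r,s]) : quatPolar r s x x = 2 * quatNorm r s x := by
  rw [quatPolar_eq, quatNorm_eq]

theorem quatNorm_mul (x y : ℍ[F,r,s]) :
    quatNorm r s (x * y) = quatNorm r s x * quatNorm r s y := by
  simp only [quatNorm_eq, QuaternionAlgebra.re_mul, QuaternionAlgebra.imI_mul,
    QuaternionAlgebra.imJ_mul, QuaternionAlgebra.imK_mul]
  ring

theorem quatNorm_one : quatNorm r s (1 : ℍ[F,r,s]) = 1 := by
  simp [quatNorm_eq]

theorem quatNorm_star (x : ℍ[F,r,s]) : quatNorm r s (star x) = quatNorm r s x := by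
  simp [quatNorm_eq]

theorem quatPolar_star_star (x y : ℍ[F,r,s]) :
    quatPolar r s (star x) (star y) = quatPolar r s x y := by
  simp [quatPolar_eq]

theorem quatPolar_mulLR (a c : (ℍ[F,r,s])ˣ) (x y : ℍ[F,r,s]) :
    quatPolar r s (mulLR a c x) (mulLR a c y) =
      quatNorm r s a * quatNorm r s c * quatPolar r s x y := by
  change quatNorm r s (a * x * c + a * y * c) - quatNorm r s (a * x * c) -
    quatNorm r s (a * y * c) = _ * (quatNorm r s (x + y) - quatNorm r s x - quatNorm r s y)
  rw [← add_mul, ← mul_add]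
  simp only [quatNorm_mul]
  ring

theorem quatNorm_unit_mul_inv (a : (ℍ[F,r,s])ˣ) :
    quatNorm r s a * quatNorm r s (a⁻¹ : (ℍ[F,r,s])ˣ) = 1 := by
  rw [← quatNorm_mul, Units.mul_inv, quatNorm_one]

theorem quatNorm_unit_ne_zero (a : (ℍ[F,r,s])ˣ) : quatNorm r s a ≠ 0 :=
  left_ne_zero_of_mul_eq_one (quatNorm_unit_mul_inv a)

theorem mul_star_eq_quatNorm (x : ℍ[F,r,s]) :
    x * star x = algebraMap F ℍ[F,r,s] (quatNorm r s x) := (quatNorm_apply r s x).symm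

theorem star_mul_eq_quatNorm (x : ℍ[F,r,s]) :
    star x * x = algebraMap F ℍ[F,r,s] (quatNorm r s x) := by
  rw [← quatNorm_star, ← mul_star_eq_quatNorm, star_star]

/-- An element of nonzero norm is invertible. -/
def unitOfNorm (x : ℍ[F,r,s]) (hx : quatNorm r s x ≠ 0) : (ℍ[F,r,s])ˣ where
  val := x
  inv := (quatNorm r s x)⁻¹ • star x
  val_inv := by
    rw [mul_smul_comm, mul_star_eq_quatNorm, Algebra.algebraMap_eq_smul_one, smul_smul,
      inv_mul_cancel₀ hx, one_smul]
  inv_val := by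
    rw [smul_mul_assoc, star_mul_eq_quatNorm, Algebra.algebraMap_eq_smul_one, smul_smul,
      inv_mul_cancel₀ hx, one_smul]

theorem star_unit_eq (a : (ℍ[F,r,s])ˣ) :
    star (a : ℍ[F,r,s]) = quatNorm r s a • ((a⁻¹ : (ℍ[F,r,s])ˣ) : ℍ[F,r,s]) := by
  have := congrArg (fun t => ((a⁻¹ : (ℍ[F,r,s])ˣ) : ℍ[F,r,s]) * t)
    (mul_star_eq_quatNorm (a : ℍ[F,r,s]))
  simpa [Algebra.algebraMap_eq_smul_one] using this

theorem re_mul_comm (x y : ℍ[F,r,s]) : (x * y).re = (y * x).re := by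
  simp; ring

theorem re_conj (a : (ℍ[F,r,s])ˣ) (x : ℍ[F,r,s]) :
    ((a : ℍ[F,r,s]) * x * ((a⁻¹ : (ℍ[F,r,s])ˣ) : ℍ[F,r,s])).re = x.re := by
  rw [re_mul_comm, Units.inv_mul_cancel_left]

variable [NeZero (2 : F)]

theorem mem_Pu {x : ℍ[F,r,s]} : x ∈ Pu r s ↔ x.re = 0 := pure_iff r s x

theorem quatPolar_nondegenerate (hr : r ≠ 0) (hs : s ≠ 0) {x : ℍ[F,r,s]}
    (hx : ∀ y, quatPolar r s x y = 0) : x = 0 := by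
  have h2 : (2 : F) ≠ 0 := NeZero.ne _
  have h0 := hx ⟨1, 0, 0, 0⟩
  have h1 := hx ⟨0, 1, 0, 0⟩
  have h3 := hx ⟨0, 0, 1, 0⟩
  have h4 := hx ⟨0, 0, 0, 1⟩
  simp [quatPolar_eq, h2, hr, hs] at h0 h1 h3 h4
  ext <;> simp [*]

theorem puPolar_nondegenerate (hr : r ≠ 0) (hs : s ≠ 0) {x : Pu r s}
    (hx : ∀ y, puPolar r s x y = 0) : x = 0 := by
  apply Subtype.ext
  refine quatPolar_nondegenerate hr hs fun y => ?_
  have hre : (x : ℍ[F,r,s]).re = 0 := mem_Pu.mp x.2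
  have := hx ⟨⟨0, y.imI, y.imJ, y.imK⟩, mem_Pu.mpr rfl⟩
  change quatPolar r s x _ = 0 at this
  rw [quatPolar_eq] at this ⊢
  simpa [hre] using this

/-- Quaternion algebras are prime rings: `ā H a = 0` only for `a = 0`. -/
theorem eq_zero_of_star_mul_mul (hr : r ≠ 0) (hs : s ≠ 0) {a : ℍ[F,r,s]}
    (ha : ∀ y, star a * y * a = 0) : a = 0 := by
  have h2 : (2 : F) ≠ 0 := NeZero.ne _
  -- Multiply `star a * y + star y * a = 2 re (star a * y)` by `a` on the right. The first term
  -- vanishes by assumption, and `a * a = 2 re a • a` because `N a = 0` (take `y = 1`).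
  have key : ∀ y, (2 * (star a * y).re) • a = (2 * a.re) • (star y * a) := by
    intro y
    have hN : quatNorm r s a = 0 := by
      have := ha 1
      rw [mul_one, star_mul_eq_quatNorm] at this
      exact (map_eq_zero_iff _ (algebraMap F ℍ[F,r,s]).injective).mp this
    have h := ha y
    rw [quatNorm_eq] at hN
    have hR := congrArg QuaternionAlgebra.re h
    have hI := congrArg QuaternionAlgebra.imI h
    have hJ := congrArg QuaternionAlgebra.imJ h
    have hK := congrArg QuaternionAlgebra.imK h
    simp at hR hI hJ hK
    ext <;> simp
    · linear_combination hR - y.re * hN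
    · linear_combination hI + y.imI * hN
    · linear_combination hJ + y.imJ * hN
    · linear_combination hK + y.imK * hN
  by_cases hT : a.re = 0
  · refine quatPolar_nondegenerate hr hs fun y => ?_
    have h := key y
    rw [hT, mul_zero, zero_smul, smul_eq_zero] at h
    rcases h with h | h
    · rw [quatPolar_eq]
      simp at h
      rcases h with h | h
      · exact absurd h h2
      · linear_combination 2 * h
    · rw [h]; simp
  · have hT' : 2 * a.re ≠ 0 := mul_ne_zero h2 hT
    -- With nonzero trace, `key` makes the left ideal `H a` one-dimensional. Then `i` and `j` act on
    -- `a` by commuting scalars, while `i j = -j i`; so `2 k a = 0`, which forces `a = 0`.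
    have scal : ∀ y, ∃ t : F, y * a = t • a := fun y => by
      refine ⟨(2 * a.re)⁻¹ * (2 * (star a * star y).re), ?_⟩
      rw [mul_smul, key, star_star, smul_smul, inv_mul_cancel₀ hT', one_smul]
    obtain ⟨t, ht⟩ := scal ⟨0, 1, 0, 0⟩
    obtain ⟨u, hu⟩ := scal ⟨0, 0, 1, 0⟩
    have hij : (⟨0, 1, 0, 0⟩ * ⟨0, 0, 1, 0⟩ : ℍ[F,r,s]) * a = (t * u) • a := by
      rw [mul_assoc, hu, mul_smul_comm, ht, smul_smul, mul_comm]
    have hji : (⟨0, 0, 1, 0⟩ * ⟨0, 1, 0, 0⟩ : ℍ[F,r,s]) * a = (t * u) • a := by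
      rw [mul_assoc, ht, mul_smul_comm, hu, smul_smul]
    have h := hij.trans hji.symm
    have hR := congrArg QuaternionAlgebra.re h
    have hI := congrArg QuaternionAlgebra.imI h
    have hJ := congrArg QuaternionAlgebra.imJ h
    have hK := congrArg QuaternionAlgebra.imK h
    simp at hR hI hJ hK
    have cancel : ∀ {c x : F}, c ≠ 0 → 2 * (c * x) = 0 → x = 0 := fun hc hx =>
      (mul_eq_zero.mp ((mul_eq_zero.mp hx).resolve_left h2)).resolve_left hc
    ext
    · exact cancel one_ne_zero (by linear_combination hK)
    · exact cancel hr (by linear_combination -hJ)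
    · exact cancel hs (by linear_combination hI)
    · exact cancel (mul_ne_zero hr hs) (by linear_combination -hR)

/-- Every automorphism of a quaternion algebra is inner. -/
theorem exists_conj (hr : r ≠ 0) (hs : s ≠ 0) (σ : ℍ[F,r,s] ≃ₗ[F] ℍ[F,r,s]) (h1 : σ 1 = 1)
    (hmul : ∀ x y, σ (x * y) = σ x * σ y) :
    ∃ a : (ℍ[F,r,s])ˣ, ∀ x, σ x = a * x * ((a⁻¹ : (ℍ[F,r,s])ˣ) : ℍ[F,r,s]) := by
  have h2 : (2 : F) ≠ 0 := NeZero.ne _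
  let i : ℍ[F,r,s] := ⟨0, 1, 0, 0⟩
  let j : ℍ[F,r,s] := ⟨0, 0, 1, 0⟩
  let k : ℍ[F,r,s] := ⟨0, 0, 0, 1⟩
  -- The average `∑ σ e * x * e⁻¹` over `e = 1, i, j, k`, which intertwines `y` and `σ y`. The last
  -- sign is negative because `k² = -r s`.
  let A : ℍ[F,r,s] → ℍ[F,r,s] := fun x =>
    x + r⁻¹ • (σ i * x * i) + s⁻¹ • (σ j * x * j) - (r * s)⁻¹ • (σ k * x * k)
  have hii : i * i = r • 1 := by ext <;> simp [i]
  have hjj : j * j = s • 1 := by ext <;> simp [j]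
  have hij : i * j = k := by ext <;> simp [i, j, k]
  have hji : j * i = -k := by ext <;> simp [i, j, k]
  have hik : i * k = r • j := by ext <;> simp [i, j, k]
  have hki : k * i = -(r • j) := by ext <;> simp [i, j, k]
  have hjk : j * k = -(s • i) := by ext <;> simp [i, j, k]
  have hkj : k * j = s • i := by ext <;> simp [i, j, k]
  have hkk : k * k = -((r * s) • 1) := by ext <;> simp [k]
  have hinter : ∀ x y, σ y * A x = A x * y := by
    intro x
    have hi : σ i * A x = A x * i := by
      simp only [A, mul_add, mul_sub, add_mul, sub_mul, mul_smul_comm, smul_mul_assoc]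
      simp only [← mul_assoc, ← hmul]
      simp only [mul_assoc, hii, hij, hik, hji, hki, map_smul, h1, mul_neg, mul_smul_comm,
        smul_mul_assoc, mul_one, one_mul]
      match_scalars <;> field_simp
    have hj : σ j * A x = A x * j := by
      simp only [A, mul_add, mul_sub, add_mul, sub_mul, mul_smul_comm, smul_mul_assoc]
      simp only [← mul_assoc, ← hmul]
      simp only [mul_assoc, hjj, hij, hjk, hji, hkj, map_neg, map_smul, h1, mul_smul_comm,
        smul_mul_assoc, mul_one, one_mul, neg_mul]
      match_scalars <;> field_simp
    have hk : σ k * A x = A x * k := by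
      rw [← hij, hmul, mul_assoc, hj, ← mul_assoc, hi, mul_assoc]
    intro y
    have hy : y = y.re • 1 + y.imI • i + y.imJ • j + y.imK • k := by
      ext <;> simp [i, j, k]
    rw [hy]
    simp only [map_add, map_smul, add_mul, mul_add, smul_mul_assoc, mul_smul_comm, hi, hj, hk, h1,
      one_mul, mul_one]
  have hne : ∃ x, A x ≠ 0 := by
    by_contra! hA
    -- Averaging a second time: each `e ≠ 1` commutes with two of the four basis elements and
    -- anticommutes with the other two, so only the term `e = 1` survives, four times. Hence `A`
    -- cannot vanish identically.
    have hsum : A 1 + r⁻¹ • (σ i * A (σ i)) + s⁻¹ • (σ j * A (σ j)) -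
        (r * s)⁻¹ • (σ k * A (σ k)) = (4 : F) • 1 := by
      simp only [A, mul_add, mul_sub, mul_smul_comm]
      simp only [← mul_assoc, ← hmul]
      simp only [hii, hjj, hkk, hij, hji, hik, hki, hjk, hkj, map_neg, map_smul, h1,
        smul_mul_assoc, mul_one, one_mul, neg_mul]
      match_scalars <;> field_simp <;> ring
    simp only [hA, mul_zero, smul_zero, add_zero, sub_zero] at hsum
    have := congrArg QuaternionAlgebra.re hsum
    simp at this
    apply h2
    have h4 : (4 : F) = 2 * 2 := by norm_num
    rw [h4] at this
    simpa using this
  obtain ⟨x, hx⟩ := hne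
  -- If the norm vanished, then `star (A x) * σ y * A x = star (A x) * A x * y = 0` for all `y`,
  -- against primeness. This replaces the argument by division, which is unavailable when `H` is
  -- split.
  have hN : quatNorm r s (A x) ≠ 0 := by
    intro hN
    apply hx
    refine eq_zero_of_star_mul_mul hr hs fun y => ?_
    obtain ⟨y, rfl⟩ := σ.surjective y
    rw [mul_assoc, hinter, ← mul_assoc, star_mul_eq_quatNorm, hN, map_zero, zero_mul]
  refine ⟨unitOfNorm (A x) hN, fun y => ?_⟩
  rw [Units.eq_mul_inv_iff_mul_eq]
  exact hinter x y

end QuaternionLemmas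

/-! ### Similitudes of the norm form and rotations of the pure quaternions. -/

section Classification

variable {F : Type*} [Field F] {r s : F}

theorem mul_self_eq_of_re {x : ℍ[F,r,s]} (hx : x.re = 0) : x * x = -quatNorm r s x • 1 := by
  ext <;> simp [quatNorm_eq, hx] <;> ring

theorem mul_add_mul_eq_of_re {x y : ℍ[F,r,s]} (hx : x.re = 0) (hy : y.re = 0) :
    x * y + y * x = -quatPolar r s x y • 1 := by
  ext <;> simp [quatPolar_eq, hx, hy] <;> ring

theorem mulLR_mem_GO (a c : (ℍ[F,r,s])ˣ) : mulLR a c ∈ GO (quatPolar r s) :=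
  ⟨_, mul_ne_zero (quatNorm_unit_ne_zero a) (quatNorm_unit_ne_zero c), quatPolar_mulLR a c⟩

variable [NeZero (2 : F)]

/-- Such a map preserves real parts and norms, so the images of `i` and `j` satisfy the defining
relations of the algebra. The condition on `k` then makes `σ` multiplicative, and `exists_conj`
applies. -/
theorem exists_conj_of_isometry (hr : r ≠ 0) (hs : s ≠ 0) (σ : ℍ[F,r,s] ≃ₗ[F] ℍ[F,r,s])
    (h1 : σ 1 = 1) (hσ : ∀ x y, quatPolar r s (σ x) (σ y) = quatPolar r s x y)
    (hk : σ ⟨0, 0, 0, 1⟩ = σ ⟨0, 1, 0, 0⟩ * σ ⟨0, 0, 1, 0⟩) :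
    ∃ a : (ℍ[F,r,s])ˣ, ∀ x, σ x = a * x * ((a⁻¹ : (ℍ[F,r,s])ˣ) : ℍ[F,r,s]) := by
  have h2 : (2 : F) ≠ 0 := NeZero.ne _
  have hre : ∀ x, (σ x).re = x.re := fun x => by
    have := hσ x 1
    rw [h1] at this
    simpa [quatPolar_eq, h2] using this
  have hN : ∀ x, quatNorm r s (σ x) = quatNorm r s x := fun x => by
    have := hσ x x
    simpa [quatPolar_self, h2] using this
  let B : QuaternionAlgebra.Basis ℍ[F,r,s] r 0 s :=
    { i := σ ⟨0, 1, 0, 0⟩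
      j := σ ⟨0, 0, 1, 0⟩
      k := σ ⟨0, 0, 0, 1⟩
      i_mul_i := by
        rw [mul_self_eq_of_re (hre _), hN]; simp [quatNorm_eq]
      j_mul_j := by
        rw [mul_self_eq_of_re (hre _), hN]; simp [quatNorm_eq]
      i_mul_j := hk.symm
      j_mul_i := by
        have := mul_add_mul_eq_of_re (hre ⟨0, 0, 1, 0⟩) (hre ⟨0, 1, 0, 0⟩)
        rw [hσ, ← hk] at this
        rw [zero_smul, zero_sub, eq_neg_iff_add_eq_zero, this]
        simp [quatPolar_eq] }
  have hB : ∀ x, σ x = B.lift x := fun x => by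
    have hx : x = x.re • 1 + x.imI • ⟨0, 1, 0, 0⟩ + x.imJ • ⟨0, 0, 1, 0⟩ +
        x.imK • ⟨0, 0, 0, 1⟩ := by ext <;> simp
    conv_lhs => rw [hx]
    simp only [map_add, map_smul, h1]
    simp [QuaternionAlgebra.Basis.lift, B, Algebra.algebraMap_eq_smul_one]
  refine exists_conj hr hs σ h1 fun x y => ?_
  rw [hB, hB, hB]
  exact map_mul B.liftHom x y

/-- An isometry of a quaternion algebra that fixes `1` is inner, up to the standard involution. -/
theorem isometry_fixing_one (hr : r ≠ 0) (hs : s ≠ 0) (σ : ℍ[F,r,s] ≃ₗ[F] ℍ[F,r,s])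
    (h1 : σ 1 = 1) (hσ : ∀ x y, quatPolar r s (σ x) (σ y) = quatPolar r s x y) :
    ∃ a : (ℍ[F,r,s])ˣ, (∀ x, σ x = a * x * ((a⁻¹ : (ℍ[F,r,s])ˣ) : ℍ[F,r,s])) ∨
      ∀ x, σ x = a * star x * ((a⁻¹ : (ℍ[F,r,s])ˣ) : ℍ[F,r,s]) := by
  have h2 : (2 : F) ≠ 0 := NeZero.ne _
  have hre : ∀ x, (σ x).re = x.re := fun x => by
    have := hσ x 1
    rw [h1] at this
    simpa [quatPolar_eq, h2] using this
  have hN : ∀ x, quatNorm r s (σ x) = quatNorm r s x := fun x => by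
    have := hσ x x
    simpa [quatPolar_self, h2] using this
  let i' := σ ⟨0, 1, 0, 0⟩
  let j' := σ ⟨0, 0, 1, 0⟩
  -- The product `i' j'` is orthogonal to `1`, `i'` and `j'`, so its preimage `w` is a multiple of
  -- `k`; comparing norms leaves `w = k` or `w = -k`.
  obtain ⟨w, hw⟩ := σ.surjective (i' * j')
  have hij : quatPolar r s i' j' = 0 := by rw [hσ]; simp [quatPolar_eq]
  have hi : i'.re = 0 := hre _
  have hj : j'.re = 0 := hre _
  have wre : w.re = 0 := by
    rw [← hre, hw]
    have : 2 * (i' * j').re = -quatPolar r s i' j' := by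
      simp [quatPolar_eq, hi, hj]; ring
    simpa [hij, h2] using this
  have wI : w.imI = 0 := by
    have h := hσ w ⟨0, 1, 0, 0⟩
    rw [hw] at h
    have h' : quatPolar r s (i' * j') i' = 0 := by
      simp [quatPolar_eq, hi, hj, h2]; ring
    rw [h'] at h
    simpa [quatPolar_eq, h2, hr] using h.symm
  have wJ : w.imJ = 0 := by
    have h := hσ w ⟨0, 0, 1, 0⟩
    rw [hw] at h
    have h' : quatPolar r s (i' * j') j' = 0 := by
      simp [quatPolar_eq, hi, hj, h2]; ring
    rw [h'] at h
    simpa [quatPolar_eq, h2, hs] using h.symm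
  have wK : w.imK = 1 ∨ w.imK = -1 := by
    have h := hN w
    rw [hw, quatNorm_mul, hN, hN] at h
    simp [quatNorm_eq, wre, wI, wJ] at h
    rw [← mul_self_eq_one_iff]
    apply mul_left_cancel₀ (mul_ne_zero hr hs)
    linear_combination -h
  rcases wK with wK | wK
  · obtain ⟨a, ha⟩ := exists_conj_of_isometry hr hs σ h1 hσ (by
      rw [← hw]; congr 1; ext <;> simp [*])
    exact ⟨a, Or.inl ha⟩
  -- Here `σ` is an antiautomorphism. Composing it with the involution negates the images of `i`,
  -- `j`, `k` and restores `k ↦` (image of `i`) (image of `j`).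
  · have e1 : star (⟨0, 1, 0, 0⟩ : ℍ[F,r,s]) = -⟨0, 1, 0, 0⟩ := by ext <;> simp
    have e2 : star (⟨0, 0, 1, 0⟩ : ℍ[F,r,s]) = -⟨0, 0, 1, 0⟩ := by ext <;> simp
    obtain ⟨a, ha⟩ := exists_conj_of_isometry hr hs ((conjEquiv r s).trans σ)
      (by change σ (star 1) = 1; rw [star_one, h1])
      (fun x y => by
        change quatPolar r s (σ (star x)) (σ (star y)) = _
        rw [hσ, quatPolar_star_star])
      (by
        change σ (star _) = σ (star _) * σ (star _)
        rw [e1, e2, map_neg, map_neg, neg_mul_neg, ← hw]; congr 1; ext <;> simp [*])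
    refine ⟨a, Or.inr fun x => ?_⟩
    have := ha (star x)
    change σ (star (star x)) = _ at this
    rwa [star_star] at this

/-- The similitudes of the norm form of a quaternion algebra. -/
theorem similitude_eq (hr : r ≠ 0) (hs : s ≠ 0) {m : ℍ[F,r,s] ≃ₗ[F] ℍ[F,r,s]}
    (hm : m ∈ GO (quatPolar r s)) :
    ∃ a c : (ℍ[F,r,s])ˣ, m = mulLR a c ∨ m = mulLR a c * conjEquiv r s := by
  have h2 : (2 : F) ≠ 0 := NeZero.ne _
  obtain ⟨d, hd, hm⟩ := hm
  have hN : quatNorm r s (m 1) = d := by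
    have := hm 1 1
    rw [quatPolar_self, quatPolar_self, quatNorm_one] at this
    apply mul_left_cancel₀ h2
    linear_combination this
  -- `N (m 1)` is the multiplier of `m`, so `m 1` is a unit, and left multiplication by its inverse
  -- turns `m` into an isometry fixing `1`.
  let u := unitOfNorm (m 1) (hN ▸ hd)
  have hu : (u : ℍ[F,r,s]) = m 1 := rfl
  have huN : quatNorm r s (u⁻¹ : (ℍ[F,r,s])ˣ) * d = 1 := by
    rw [← hN, ← hu, mul_comm, quatNorm_unit_mul_inv]
  obtain ⟨a, ha⟩ := isometry_fixing_one hr hs (m.trans (mulLR u⁻¹ 1))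
    (by change (u⁻¹ : (ℍ[F,r,s])ˣ) * m 1 * (1 : (ℍ[F,r,s])ˣ) = (1 : ℍ[F,r,s])
        rw [← hu]; simp)
    (fun x y => by
      rw [LinearEquiv.trans_apply, LinearEquiv.trans_apply, quatPolar_mulLR, hm, Units.val_one,
        quatNorm_one, mul_one, ← mul_assoc, huN, one_mul])
  have key : ∀ x y, (m.trans (mulLR u⁻¹ 1)) x = y → m x = u * y := fun x y hxy => by
    change (u⁻¹ : (ℍ[F,r,s])ˣ) * m x * (1 : (ℍ[F,r,s])ˣ) = y at hxy
    rw [← hxy]; simp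
  refine ⟨u * a, a⁻¹, ha.imp (fun h => ?_) (fun h => ?_)⟩
  · ext1 x
    rw [key x _ (h x)]
    simp [mulLR, mul_assoc]
  · ext1 x
    rw [key x _ (h x)]
    simp [mulLR, conjEquiv, mul_assoc]

theorem GO_quatPolar (hr : r ≠ 0) (hs : s ≠ 0) :
    GO (quatPolar r s) = Subgroup.closure
      ({conjEquiv r s} ∪ {m | ∃ a : (ℍ[F,r,s])ˣ, m = mulLR a 1} ∪
        {m | ∃ c : (ℍ[F,r,s])ˣ, m = mulLR 1 c}) := by
  apply le_antisymm
  · intro m hm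
    have hmem : ∀ a c : (ℍ[F,r,s])ˣ, mulLR a c ∈ Subgroup.closure
      ({conjEquiv r s} ∪ {m | ∃ a : (ℍ[F,r,s])ˣ, m = mulLR a 1} ∪
        {m | ∃ c : (ℍ[F,r,s])ˣ, m = mulLR 1 c}) := fun a c => by
      have : mulLR a c = mulLR a 1 * mulLR 1 c := by
        ext1 x
        simp [mulLR, mul_assoc]
      rw [this]
      exact mul_mem (Subgroup.subset_closure (Or.inl (Or.inr ⟨a, rfl⟩)))
        (Subgroup.subset_closure (Or.inr ⟨c, rfl⟩))
    obtain ⟨a, c, rfl | rfl⟩ := similitude_eq hr hs hm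
    · exact hmem a c
    · exact mul_mem (hmem a c) (Subgroup.subset_closure (Or.inl (Or.inl rfl)))
  · rw [Subgroup.closure_le]
    rintro m ((rfl | ⟨a, rfl⟩) | ⟨c, rfl⟩)
    · exact ⟨1, one_ne_zero, fun x y => by rw [one_mul]; exact quatPolar_star_star x y⟩
    · exact mulLR_mem_GO a 1
    · exact mulLR_mem_GO 1 c

/-- Conjugation by a unit, as a linear transformation of the space of pure quaternions. -/
def puConj (a : (ℍ[F,r,s])ˣ) : Pu r s ≃ₗ[F] Pu r s where
  toFun x := ⟨a * x * (a⁻¹ : (ℍ[F,r,s])ˣ), mem_Pu.mpr ((re_conj a x).trans (mem_Pu.mp x.2))⟩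
  invFun x := ⟨(a⁻¹ : (ℍ[F,r,s])ˣ) * x * a, mem_Pu.mpr (by
    have := re_conj a⁻¹ (x : ℍ[F,r,s])
    rw [inv_inv] at this
    exact this.trans (mem_Pu.mp x.2))⟩
  map_add' x y := Subtype.ext (by simp [mul_add, add_mul])
  map_smul' t x := Subtype.ext (by simp)
  left_inv x := Subtype.ext (by simp [mul_assoc])
  right_inv x := Subtype.ext (by simp [mul_assoc])

/-- The coordinates of a pure quaternion. -/
def puCoord (r s : F) : Pu r s ≃ₗ[F] (Fin 3 → F) where
  toFun x := ![x.1.imI, x.1.imJ, x.1.imK]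
  invFun v := ⟨⟨0, v 0, v 1, v 2⟩, mem_Pu.mpr rfl⟩
  map_add' x y := by ext i; fin_cases i <;> simp
  map_smul' t x := by ext i; fin_cases i <;> simp
  left_inv x := Subtype.ext (by
    have := mem_Pu.mp x.2
    ext <;> simp [this])
  right_inv v := by ext i; fin_cases i <;> simp

theorem finrank_Pu : finrank F (Pu r s) = 3 := by
  rw [(puCoord r s).finrank_eq, Module.finrank_fin_fun]

/-- A volume form on `Pu H` expressed through the multiplication alone; conjugations preserve it,
and this gives `det_puConj`. -/
theorem re_triple_eq_det (v : Fin 3 → Pu r s) :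
    (((v 0 : ℍ[F,r,s]) * v 1 - v 1 * v 0) * v 2).re =
      -(2 * r * s) * (Basis.ofEquivFun (puCoord r s)).det v := by
  have h0 := mem_Pu.mp (v 0).2
  have h1 := mem_Pu.mp (v 1).2
  have h2 := mem_Pu.mp (v 2).2
  rw [Basis.det_apply, Matrix.det_fin_three]
  simp [Basis.toMatrix_apply, puCoord, h0, h1, h2]
  ring

theorem det_puConj (hr : r ≠ 0) (hs : s ≠ 0) (a : (ℍ[F,r,s])ˣ) :
    LinearMap.det (puConj a : Pu r s →ₗ[F] Pu r s) = 1 := by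
  have h2 : (2 : F) ≠ 0 := NeZero.ne _
  let e := Basis.ofEquivFun (puCoord r s)
  have key := re_triple_eq_det (fun i => puConj a (e i))
  have h0 := re_triple_eq_det (r := r) (s := s) (fun i => e i)
  have hconj : ∀ x y z : ℍ[F,r,s],
      ((a * x * (a⁻¹ : (ℍ[F,r,s])ˣ) * (a * y * (a⁻¹ : (ℍ[F,r,s])ˣ)) -
        a * y * (a⁻¹ : (ℍ[F,r,s])ˣ) * (a * x * (a⁻¹ : (ℍ[F,r,s])ˣ))) *
        (a * z * (a⁻¹ : (ℍ[F,r,s])ˣ))).re = ((x * y - y * x) * z).re := by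
    intro x y z
    rw [← re_conj a ((x * y - y * x) * z)]
    congr 1
    simp [mul_sub, sub_mul, mul_assoc]
  have h3 := (hconj (e 0) (e 1) (e 2)).symm.trans key
  rw [h0] at h3
  have h4 : (fun i => puConj a (e i)) = (puConj a : Pu r s →ₗ[F] Pu r s) ∘ e := rfl
  rw [h4, Basis.det_comp] at h3
  change _ * e.det e = _ at h3
  rw [Basis.det_self, mul_one, mul_one] at h3
  have hne : -(2 * r * s) ≠ 0 := neg_ne_zero.mpr (mul_ne_zero (mul_ne_zero h2 hr) hs)
  exact (mul_left_cancel₀ hne ((mul_one _).trans h3)).symm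

theorem puConj_mem_SO (hr : r ≠ 0) (hs : s ≠ 0) (a : (ℍ[F,r,s])ˣ) :
    puConj a ∈ SO (puPolar r s) := by
  refine ⟨fun x y => ?_, Units.ext ?_⟩
  · have := quatPolar_mulLR a a⁻¹ (x : ℍ[F,r,s]) y
    rw [quatNorm_unit_mul_inv, one_mul] at this
    exact this
  · rw [LinearEquiv.coe_det, det_puConj hr hs, Units.val_one]

/-- Every rotation of the space of pure quaternions is conjugation by a unit. -/
theorem exists_puConj (hr : r ≠ 0) (hs : s ≠ 0) {t : Pu r s ≃ₗ[F] Pu r s}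
    (ht : t ∈ SO (puPolar r s)) : ∃ a : (ℍ[F,r,s])ˣ, t = puConj a := by
  have h2 : (2 : F) ≠ 0 := NeZero.ne _
  obtain ⟨hiso, hdet⟩ := ht
  let pr : ℍ[F,r,s] →ₗ[F] Pu r s :=
    { toFun := fun x => ⟨⟨0, x.imI, x.imJ, x.imK⟩, mem_Pu.mpr rfl⟩
      map_add' := fun x y => Subtype.ext (by ext <;> simp)
      map_smul' := fun c x => Subtype.ext (by ext <;> simp) }
  -- Extend by fixing `1`, so that `isometry_fixing_one` applies to the whole algebra.
  let extend : (Pu r s →ₗ[F] Pu r s) → (ℍ[F,r,s] →ₗ[F] ℍ[F,r,s]) := fun t =>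
    { toFun := fun x => x.re • 1 + (t (pr x) : ℍ[F,r,s])
      map_add' := fun x y => by simp [add_smul]; abel
      map_smul' := fun c x => by simp [mul_smul] }
  have hpu : ∀ x : Pu r s, pr x = x := fun x => Subtype.ext (by
    have := mem_Pu.mp x.2
    ext <;> simp [pr, this])
  have hpre : ∀ x : Pu r s, (x : ℍ[F,r,s]).re = 0 := fun x => mem_Pu.mp x.2
  have hone : pr 1 = 0 := Subtype.ext (by ext <;> simp [pr])
  have hdec : ∀ x : ℍ[F,r,s], x.re • 1 + (pr x : ℍ[F,r,s]) = x := fun x => by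
    ext <;> simp [pr]
  have hinv : ∀ t t' : Pu r s →ₗ[F] Pu r s, t' ∘ₗ t = LinearMap.id → extend t' ∘ₗ extend t =
      LinearMap.id := fun t t' h => by
    ext1 x
    have : t' (t (pr x)) = pr x := LinearMap.congr_fun h _
    simp only [extend, LinearMap.comp_apply, LinearMap.coe_mk, AddHom.coe_mk, map_add, map_smul,
      hone, hpu, hpre, this, LinearMap.id_apply, QuaternionAlgebra.re_one, map_zero,
      ZeroMemClass.coe_zero, one_smul, zero_smul, zero_add, add_zero, hdec]
  let σ : ℍ[F,r,s] ≃ₗ[F] ℍ[F,r,s] := LinearEquiv.ofLinearMap (extend t) (extend t.symm)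
    (hinv _ _ (by ext1 x; simp)) (hinv _ _ (by ext1 x; simp))
  have hσ : ∀ x, σ x = x.re • 1 + (t (pr x) : ℍ[F,r,s]) := fun x => rfl
  have hpol : ∀ (c d : F) (x y : Pu r s), quatPolar r s (c • 1 + (x : ℍ[F,r,s])) (d • 1 + y) =
      2 * (c * d) + puPolar r s x y := fun c d x y => by
    change _ = _ + quatPolar r s x y
    simp [quatPolar_eq, hpre]
    ring
  obtain ⟨a, ha | ha⟩ := isometry_fixing_one hr hs σ (by rw [hσ, hone]; simp) (fun x y => by
    rw [hσ, hσ, hpol, hiso, ← hpol, hdec, hdec])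
  · refine ⟨a, LinearEquiv.ext fun x => Subtype.ext ?_⟩
    have := ha x
    rw [hσ, hpu, hpre, zero_smul, zero_add] at this
    exact this
  -- The involution is `-1` on `Pu H`, so this case gives `t = -puConj a`, of determinant `(-1)³ =
  -- -1 ≠ 1`.
  · exfalso
    have hta : (t : Pu r s →ₗ[F] Pu r s) = (-1 : F) • (puConj a : Pu r s →ₗ[F] Pu r s) := by
      refine LinearMap.ext fun x => Subtype.ext ?_
      have := ha x
      have hst : star (x : ℍ[F,r,s]) = -x := by ext <;> simp [hpre]
      rw [hσ, hpu, hpre, zero_smul, zero_add, hst] at this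
      simpa [puConj] using this
    have h3 := congrArg LinearMap.det hta
    rw [LinearMap.det_smul, det_puConj hr hs, finrank_Pu, ← LinearEquiv.coe_det, hdet] at h3
    apply h2
    simp at h3
    linear_combination h3

end Classification

/-! ### The map from `⋀² V` to the pure quaternions and the forms it pulls back. -/

section PureWedge

variable {F : Type*} [Field F] {r s : F}

/-- The determinant of four quaternions in the basis `1, i, j, k`. -/
def quatDet (v : Fin 4 → ℍ[F,r,s]) : F := (QuaternionAlgebra.basisOneIJK r 0 s).det v

theorem quatDet_eq (v : Fin 4 → ℍ[F,r,s]) : quatDet v = Matrix.det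
    !![(v 0).re, (v 1).re, (v 2).re, (v 3).re; (v 0).imI, (v 1).imI, (v 2).imI, (v 3).imI;
      (v 0).imJ, (v 1).imJ, (v 2).imJ, (v 3).imJ; (v 0).imK, (v 1).imK, (v 2).imK, (v 3).imK] := by
  rw [quatDet, Basis.det_apply]
  congr 1
  ext i j
  rw [Basis.toMatrix_apply, QuaternionAlgebra.coe_basisOneIJK_repr]
  fin_cases i <;> fin_cases j <;> rfl

/-- The polynomial identity behind everything: one form on `Pu H` yields both `⋀² f_N` and the
Pfaffian form (the determinant of four vectors). -/
theorem quatPolar_wedge (x y z w : ℍ[F,r,s]) :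
    quatPolar r s (x * star y - y * star x) (z * star w - w * star z) =
      2 * (quatPolar r s x z * quatPolar r s y w - quatPolar r s x w * quatPolar r s y z) +
        8 * r * s * quatDet ![x, y, z, w] := by
  rw [quatDet_eq]
  simp only [quatPolar_eq, QuaternionAlgebra.re_sub, QuaternionAlgebra.imI_sub,
    QuaternionAlgebra.imJ_sub, QuaternionAlgebra.imK_sub, QuaternionAlgebra.re_mul,
    QuaternionAlgebra.imI_mul, QuaternionAlgebra.imJ_mul, QuaternionAlgebra.imK_mul,
    QuaternionAlgebra.re_star, QuaternionAlgebra.imI_star, QuaternionAlgebra.imJ_star,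
    QuaternionAlgebra.imK_star]
  simp [Matrix.det_succ_row_zero, Fin.sum_univ_succ, Fin.succAbove]
  ring

theorem quatDet_star (x y z w : ℍ[F,r,s]) :
    quatDet ![star x, star y, star z, star w] = -quatDet ![x, y, z, w] := by
  rw [quatDet_eq, quatDet_eq]
  simp [Matrix.det_succ_row_zero, Fin.sum_univ_succ, Fin.succAbove]
  ring

variable [NeZero (2 : F)] {V : Type*} [AddCommGroup V] [Module F V]

theorem puPolar_apply (x y : Pu r s) : puPolar r s x y = quatPolar r s x y := rfl

/-- The alternating map `(x, y) ↦ φ x * star (φ y) - φ y * star (φ x)`. -/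
def pureAlternating (φ : V ≃ₗ[F] ℍ[F,r,s]) : V [⋀^Fin 2]→ₗ[F] Pu r s where
  toFun v := ⟨φ (v 0) * star (φ (v 1)) - φ (v 1) * star (φ (v 0)), mem_Pu.mpr (by simp; ring)⟩
  map_update_add' v i x y := by
    apply Subtype.ext
    fin_cases i <;> simp [mul_add, add_mul] <;> abel
  map_update_smul' v i c x := by
    apply Subtype.ext
    fin_cases i <;> simp [smul_sub]
  map_eq_zero_of_eq' v i j hv hij := by
    apply Subtype.ext
    have : v 0 = v 1 := by fin_cases i <;> fin_cases j <;> simp_all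
    simp [this]

/-- The linear map `x ∧ y ↦ φ x * star (φ y) - φ y * star (φ x)` from `⋀² V` to the space of pure
quaternions. -/
def pureWedge (φ : V ≃ₗ[F] ℍ[F,r,s]) : ⋀[F]^2 V →ₗ[F] Pu r s :=
  exteriorPower.alternatingMapLinearEquiv (pureAlternating φ)

theorem pureWedge_ιMulti (φ : V ≃ₗ[F] ℍ[F,r,s]) (v : Fin 2 → V) :
    (pureWedge φ (exteriorPower.ιMulti F 2 v) : ℍ[F,r,s]) =
      φ (v 0) * star (φ (v 1)) - φ (v 1) * star (φ (v 0)) := by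
  rw [pureWedge, exteriorPower.alternatingMapLinearEquiv_apply_ιMulti]
  rfl

theorem pureWedge_map {U : Type*} [AddCommGroup U] [Module F U] (φ : U ≃ₗ[F] ℍ[F,r,s])
    (l : V ≃ₗ[F] U) (w : ⋀[F]^2 V) :
    pureWedge φ (exteriorPower.map 2 (l : V →ₗ[F] U) w) = pureWedge (l.trans φ) w := by
  have : pureWedge φ ∘ₗ exteriorPower.map 2 (l : V →ₗ[F] U) = pureWedge (l.trans φ) := by
    apply LinearMap.ext_on (exteriorPower.ιMulti_span F 2 V)
    rintro _ ⟨v, rfl⟩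
    apply Subtype.ext
    rw [LinearMap.comp_apply, exteriorPower.map_apply_ιMulti, pureWedge_ιMulti, pureWedge_ιMulti]
    rfl
  exact LinearMap.congr_fun this w

/-- In `(a x c) * star (a y c)` the factor `c * star c = N c` is central, and `star a = N a • a⁻¹`.
The right factor therefore acts through its norm only. -/
theorem pureWedge_trans_mulLR (φ : V ≃ₗ[F] ℍ[F,r,s]) (a c : (ℍ[F,r,s])ˣ) (w : ⋀[F]^2 V) :
    pureWedge (φ.trans (mulLR a c)) w =
      (quatNorm r s a * quatNorm r s c) • puConj a (pureWedge φ w) := by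
  have : pureWedge (φ.trans (mulLR a c)) =
      (quatNorm r s a * quatNorm r s c) • (puConj a : Pu r s →ₗ[F] Pu r s) ∘ₗ pureWedge φ := by
    apply LinearMap.ext_on (exteriorPower.ιMulti_span F 2 V)
    rintro _ ⟨v, rfl⟩
    apply Subtype.ext
    rw [pureWedge_ιMulti]
    change _ = (quatNorm r s a * quatNorm r s c) •
      ((a : ℍ[F,r,s]) * (pureWedge φ (exteriorPower.ιMulti F 2 v) : ℍ[F,r,s]) *
        (a⁻¹ : (ℍ[F,r,s])ˣ))
    rw [pureWedge_ιMulti]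
    have key : ∀ x y : ℍ[F,r,s], (a * x * c) * star (a * y * c) =
        (quatNorm r s a * quatNorm r s c) • (a * (x * star y) * (a⁻¹ : (ℍ[F,r,s])ˣ)) := by
      intro x y
      have : (a * x * c) * star (a * y * c) =
          a * (x * ((c : ℍ[F,r,s]) * star (c : ℍ[F,r,s])) * star y) * star (a : ℍ[F,r,s]) := by
        simp only [star_mul, mul_assoc]
      rw [this, mul_star_eq_quatNorm, star_unit_eq, Algebra.algebraMap_eq_smul_one]
      simp only [mul_smul_comm, smul_mul_assoc, mul_one, smul_smul]
    change (a * φ (v 0) * c) * star (a * φ (v 1) * c) -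
      (a * φ (v 1) * c) * star (a * φ (v 0) * c) = _
    rw [key, key, mul_sub, sub_mul, smul_sub]
  exact LinearMap.congr_fun this w

theorem exists_puPolar_pureWedge (hr : r ≠ 0) (hs : s ≠ 0) {h : LinearMap.BilinForm F V}
    (b : ⋀[F]^4 V ≃ₗ[F] F) {φ : V ≃ₗ[F] ℍ[F,r,s]} {c : F}
    (hφ : ∀ x y, quatPolar r s (φ x) (φ y) = c * h x y) :
    ∃ κ : F, κ ≠ 0 ∧ (∀ x y, puPolar r s (pureWedge φ x) (pureWedge φ y) =
        2 * c ^ 2 * extForm 2 h x y + κ * pf b x y) ∧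
      ∀ x y, puPolar r s (pureWedge (φ.trans (conjEquiv r s)) x)
        (pureWedge (φ.trans (conjEquiv r s)) y) =
          2 * c ^ 2 * extForm 2 h x y - κ * pf b x y := by
  have h2 : (2 : F) ≠ 0 := NeZero.ne _
  let e := (QuaternionAlgebra.basisOneIJK r 0 s).map φ.symm
  let f : V [⋀^Fin 4]→ₗ[F] F :=
    (b : ⋀[F]^4 V →ₗ[F] F).compAlternatingMap (exteriorPower.ιMulti F 4)
  have hf := f.eq_smul_basis_det e
  -- An alternating 4-form on `V` is a multiple of the determinant; if it vanished on a basis, then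
  -- `b` would be zero.
  have hβ : f e ≠ 0 := by
    intro h0
    rw [h0, zero_smul] at hf
    have hb : (b : ⋀[F]^4 V →ₗ[F] F) = 0 := by
      apply exteriorPower.linearMap_ext
      exact hf
    have := LinearMap.congr_fun hb (b.symm 1)
    simp at this
  have hdet : ∀ v w : Fin 2 → V, quatDet ![φ (v 0), φ (v 1), φ (w 0), φ (w 1)] =
      (f e)⁻¹ * pf b (exteriorPower.ιMulti F 2 v) (exteriorPower.ιMulti F 2 w) := by
    intro v w
    rw [pf_apply, wedge_ιMulti]
    have h1 : b (exteriorPower.ιMulti F 4 (Fin.append v w)) = f (Fin.append v w) := rfl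
    have h3 : f (Fin.append v w) = f e * e.det (Fin.append v w) := AlternatingMap.congr_fun hf _
    rw [h1, h3, inv_mul_cancel_left₀ hβ, quatDet, Basis.det_map]
    congr 1
    funext i
    fin_cases i <;> rfl
  -- `8 r s` comes from `quatPolar_wedge`; `(f e)⁻¹` converts `Pf` into the determinant with respect
  -- to the basis `1, i, j, k`.
  refine ⟨8 * r * s * (f e)⁻¹, ?_, fun x y => ?_, fun x y => ?_⟩
  · have h8 : (8 : F) = 2 * 2 * 2 := by norm_num
    rw [h8]
    simp [h2, hr, hs, hβ]
  · refine bilin_ext ((puPolar r s).compl₁₂ (pureWedge φ) (pureWedge φ))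
      ((2 * c ^ 2) • extForm 2 h + (8 * r * s * (f e)⁻¹) • pf b) (fun v w => ?_) x y
    simp only [LinearMap.compl₁₂_apply, LinearMap.add_apply, LinearMap.smul_apply, smul_eq_mul]
    rw [puPolar_apply, pureWedge_ιMulti, pureWedge_ιMulti, quatPolar_wedge, hdet, extForm_ιMulti,
      Matrix.det_fin_two]
    simp only [hφ, Matrix.of_apply]
    ring
  · refine bilin_ext ((puPolar r s).compl₁₂ (pureWedge (φ.trans (conjEquiv r s)))
        (pureWedge (φ.trans (conjEquiv r s))))
      ((2 * c ^ 2) • extForm 2 h - (8 * r * s * (f e)⁻¹) • pf b) (fun v w => ?_) x y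
    simp only [LinearMap.compl₁₂_apply, LinearMap.sub_apply, LinearMap.smul_apply, smul_eq_mul]
    have hst : ∀ x, (φ.trans (conjEquiv r s)) x = star (φ x) := fun _ => rfl
    rw [puPolar_apply, pureWedge_ιMulti, pureWedge_ιMulti, quatPolar_wedge]
    simp only [hst]
    rw [quatDet_star, hdet, extForm_ιMulti, Matrix.det_fin_two]
    simp only [hφ, Matrix.of_apply, quatPolar_star_star]
    ring

end PureWedge

/-! ### The eigenspaces of the Hodge operator. -/

section HodgeEigenspaces

variable {F : Type*} [Field F] {r s : F} {V : Type*} [AddCommGroup V] [Module F V]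

theorem trans_conjEquiv_trans_conjEquiv (φ : V ≃ₗ[F] ℍ[F,r,s]) :
    (φ.trans (conjEquiv r s)).trans (conjEquiv r s) = φ := by
  ext1 x
  exact star_star _

theorem conjEquiv_mulLR (a c : (ℍ[F,r,s])ˣ) (x : ℍ[F,r,s]) :
    conjEquiv r s (mulLR a c x) = mulLR (star c) (star a) (conjEquiv r s x) := by
  simp [conjEquiv, mulLR, mul_assoc]

theorem quatPolar_trans_conjEquiv {h : LinearMap.BilinForm F V} {φ : V ≃ₗ[F] ℍ[F,r,s]} {c : F}
    (hφ : ∀ x y, quatPolar r s (φ x) (φ y) = c * h x y) (x y : V) :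
    quatPolar r s (φ.trans (conjEquiv r s) x) (φ.trans (conjEquiv r s) y) = c * h x y := by
  rw [← hφ]
  exact quatPolar_star_star _ _

theorem trans_transport {U : Type*} [AddCommGroup U] [Module F U] (φ : V ≃ₗ[F] U)
    (l : V ≃ₗ[F] V) : l.trans φ = φ.trans (transport φ l) := by
  ext1 x
  simp [transport]

theorem transport_apply_apply {U U' : Type*} [AddCommMonoid U] [Module F U] [AddCommMonoid U']
    [Module F U'] (φ : U ≃ₗ[F] U') (l : U ≃ₗ[F] U) (x : U) : transport φ l (φ x) = φ (l x) := by
  simp [transport]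

theorem hodge_smul (hV : finrank F V = 4) (h : LinearMap.BilinForm F V) (b : ⋀[F]^4 V ≃ₗ[F] F)
    (t : Fˣ) (x : ⋀[F]^2 V) :
    hodge hV h (b.trans (LinearEquiv.smulOfUnit t)) x = (t : F)⁻¹ • hodge hV h b x := by
  apply pf_injective hV (b.trans (LinearEquiv.smulOfUnit t))
  refine LinearMap.ext fun y => ?_
  have hpf : ∀ u v, pf (b.trans (LinearEquiv.smulOfUnit t)) u v = t * pf b u v := fun u v => rfl
  rw [pf_hodge, map_smul, LinearMap.smul_apply, hpf, pf_hodge, smul_eq_mul,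
    inv_mul_cancel_left₀ t.ne_zero]

theorem act_one_sub_kp (hV : finrank F V = 4) (h : LinearMap.BilinForm F V)
    (b : ⋀[F]^4 V ≃ₗ[F] F) (x : ⋀[F]^2 V) :
    act hV h b (1 - kp h b) x = x - act hV h b (kp h b) x := by
  simp [act, sub_smul]
  abel

variable [NeZero (2 : F)]

/-- The difference of the two pulled-back forms is `2κ Pf`, and `Pf` is non-degenerate. -/
theorem pureWedge_ext (hV : finrank F V = 4) {h : LinearMap.BilinForm F V}
    (b : ⋀[F]^4 V ≃ₗ[F] F) {φ : V ≃ₗ[F] ℍ[F,r,s]} {c : F} (hr : r ≠ 0) (hs : s ≠ 0)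
    (hφ : ∀ x y, quatPolar r s (φ x) (φ y) = c * h x y) {x y : ⋀[F]^2 V}
    (h1 : pureWedge φ x = pureWedge φ y)
    (h2 : pureWedge (φ.trans (conjEquiv r s)) x = pureWedge (φ.trans (conjEquiv r s)) y) :
    x = y := by
  have h2' : (2 : F) ≠ 0 := NeZero.ne _
  obtain ⟨κ, hκ, hP, hM⟩ := exists_puPolar_pureWedge hr hs b hφ
  apply pf_injective hV b
  refine LinearMap.ext fun z => ?_
  apply mul_left_cancel₀ (mul_ne_zero h2' hκ)
  have e1 := hP x z
  have e2 := hM x z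
  rw [h1, hP] at e1
  rw [h2, hM] at e2
  linear_combination e2 - e1

/-- `⋀² V` is the direct sum of two copies of the space of pure quaternions. -/
theorem exists_pureWedge_eq (hV : finrank F V = 4) {h : LinearMap.BilinForm F V}
    (b : ⋀[F]^4 V ≃ₗ[F] F) {φ : V ≃ₗ[F] ℍ[F,r,s]} {c : F} (hr : r ≠ 0) (hs : s ≠ 0)
    (hφ : ∀ x y, quatPolar r s (φ x) (φ y) = c * h x y) (u v : Pu r s) :
    ∃ w, pureWedge φ w = u ∧ pureWedge (φ.trans (conjEquiv r s)) w = v := by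
  have : FiniteDimensional F V := FiniteDimensional.of_finrank_pos (by omega)
  have : FiniteDimensional F (Pu r s) := FiniteDimensional.of_finrank_pos (by
    rw [finrank_Pu]; omega)
  let Ψ := (pureWedge φ).prod (pureWedge (φ.trans (conjEquiv r s)))
  have hinj : Function.Injective Ψ := fun x y hxy =>
    pureWedge_ext hV b hr hs hφ (congrArg Prod.fst hxy) (congrArg Prod.snd hxy)
  have hsurj : Function.Surjective Ψ :=
    (LinearMap.injective_iff_surjective_of_finrank_eq_finrank (by
      rw [exteriorPower.finrank_eq, hV, Module.finrank_prod, finrank_Pu]; rfl)).mp hinj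
  obtain ⟨w, hw⟩ := hsurj (u, v)
  exact ⟨w, congrArg Prod.fst hw, congrArg Prod.snd hw⟩

/-- The maps `pureWedge φ` and `pureWedge φ̄` diagonalize the Hodge operator. -/
theorem exists_pureWedge_hodge (hV : finrank F V = 4) {h : LinearMap.BilinForm F V}
    (b : ⋀[F]^4 V ≃ₗ[F] F) {φ : V ≃ₗ[F] ℍ[F,r,s]} {c : F} (hr : r ≠ 0) (hs : s ≠ 0) (hc : c ≠ 0)
    (hφ : ∀ x y, quatPolar r s (φ x) (φ y) = c * h x y) :
    ∃ κ : F, κ ≠ 0 ∧ (∀ x, pureWedge φ (hodge hV h b x) = κ • pureWedge φ x) ∧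
      ∀ x, pureWedge (φ.trans (conjEquiv r s)) (hodge hV h b x) =
        -κ • pureWedge (φ.trans (conjEquiv r s)) x := by
  have h2' : (2 : F) ≠ 0 := NeZero.ne _
  obtain ⟨κ, hκ, hP, hM⟩ := exists_puPolar_pureWedge hr hs b hφ
  have hP2 : 2 * c ^ 2 ≠ 0 := mul_ne_zero h2' (pow_ne_zero 2 hc)
  -- The difference of the pulled-back forms is `2κ Pf`, their sum is `4c² ⋀² h`, and `J` carries
  -- one to the other. Choosing `y` with one component zero then isolates each eigenvalue.
  have key : ∀ x y, (2 * c ^ 2) *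
      (puPolar r s (pureWedge φ (hodge hV h b x)) (pureWedge φ y) -
      puPolar r s (pureWedge (φ.trans (conjEquiv r s)) (hodge hV h b x))
        (pureWedge (φ.trans (conjEquiv r s)) y)) =
      κ * (puPolar r s (pureWedge φ x) (pureWedge φ y) +
        puPolar r s (pureWedge (φ.trans (conjEquiv r s)) x)
          (pureWedge (φ.trans (conjEquiv r s)) y)) := fun x y => by
    rw [hP, hM, hP, hM, pf_hodge]
    ring
  refine ⟨(2 * c ^ 2)⁻¹ * κ, mul_ne_zero (inv_ne_zero hP2) hκ, fun x => ?_, fun x => ?_⟩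
  · rw [← sub_eq_zero]
    refine puPolar_nondegenerate hr hs fun u => ?_
    obtain ⟨y, rfl, h0⟩ := exists_pureWedge_eq hV b hr hs hφ u 0
    have := key x y
    rw [h0, map_zero, map_zero, sub_zero, add_zero] at this
    rw [map_sub, LinearMap.sub_apply, map_smul, LinearMap.smul_apply, smul_eq_mul, mul_assoc,
      ← this, inv_mul_cancel_left₀ hP2, sub_self]
  · rw [← sub_eq_zero]
    refine puPolar_nondegenerate hr hs fun u => ?_
    obtain ⟨y, h0, rfl⟩ := exists_pureWedge_eq hV b hr hs hφ 0 u
    have := key x y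
    rw [h0, map_zero, map_zero, zero_sub, zero_add] at this
    rw [map_sub, LinearMap.sub_apply, map_smul, LinearMap.smul_apply, smul_eq_mul, neg_mul,
      mul_assoc, ← this, inv_mul_cancel_left₀ hP2, neg_neg, sub_self]

theorem exists_isNormalized (hV : finrank F V = 4) {h : LinearMap.BilinForm F V}
    (b : ⋀[F]^4 V ≃ₗ[F] F) {φ : V ≃ₗ[F] ℍ[F,r,s]} {c : F} (hr : r ≠ 0) (hs : s ≠ 0) (hc : c ≠ 0)
    (hφ : ∀ x y, quatPolar r s (φ x) (φ y) = c * h x y) :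
    ∃ b₀ : ⋀[F]^4 V ≃ₗ[F] F, IsNormalized hV h b₀ := by
  obtain ⟨κ, hκ, hu, hv⟩ := exists_pureWedge_hodge hV b hr hs hc hφ
  -- Scaling `b` by `κ` divides `J` by `κ`, and the eigenvalues become `±1`.
  refine ⟨b.trans (LinearEquiv.smulOfUnit (Units.mk0 κ hκ)), LinearMap.ext fun x => ?_⟩
  rw [LinearMap.comp_apply, hodge_smul, hodge_smul, map_smul, LinearMap.id_apply]
  apply pureWedge_ext hV b hr hs hφ
  · simp only [map_smul, hu, smul_smul, Units.val_mk0]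
    rw [show κ⁻¹ * κ⁻¹ * (κ * κ) = 1 by field_simp, one_smul]
  · simp only [map_smul, hv, smul_smul, Units.val_mk0]
    rw [show κ⁻¹ * κ⁻¹ * (-κ * -κ) = 1 by field_simp, one_smul]

/-- `φ` is adapted to `b` if `pureWedge φ` and `pureWedge φ̄` vanish on the eigenspaces of the Hodge
operator for the eigenvalues `-1` and `1`, respectively. -/
def IsAdapted (hV : finrank F V = 4) (h : LinearMap.BilinForm F V) (b : ⋀[F]^4 V ≃ₗ[F] F)
    (φ : V ≃ₗ[F] ℍ[F,r,s]) : Prop :=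
  (∀ x, pureWedge φ (hodge hV h b x) = pureWedge φ x) ∧
    ∀ x, pureWedge (φ.trans (conjEquiv r s)) (hodge hV h b x) =
      -pureWedge (φ.trans (conjEquiv r s)) x

theorem exists_isAdapted (hV : finrank F V = 4) {h : LinearMap.BilinForm F V}
    {b : ⋀[F]^4 V ≃ₗ[F] F} {φ : V ≃ₗ[F] ℍ[F,r,s]} {c : F} (hr : r ≠ 0) (hs : s ≠ 0) (hc : c ≠ 0)
    (hφ : ∀ x y, quatPolar r s (φ x) (φ y) = c * h x y) (hb : IsNormalized hV h b) :
    ∃ ψ : V ≃ₗ[F] ℍ[F,r,s], (∀ x y, quatPolar r s (ψ x) (ψ y) = c * h x y) ∧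
      IsAdapted hV h b ψ := by
  obtain ⟨κ, hκ, hu, hv⟩ := exists_pureWedge_hodge hV b hr hs hc hφ
  let i : Pu r s := ⟨⟨0, 1, 0, 0⟩, mem_Pu.mpr rfl⟩
  obtain ⟨w, hw, -⟩ := exists_pureWedge_eq hV b hr hs hφ i 0
  have h1 : κ * κ = 1 := by
    have h1 : hodge hV h b (hodge hV h b w) = w := LinearMap.congr_fun hb w
    have h2 := congrArg (pureWedge φ) h1
    rw [hu, hu, hw, smul_smul] at h2
    have := congrArg (fun x : Pu r s => (x : ℍ[F,r,s]).imI) h2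
    simpa [i] using this
  rcases mul_self_eq_one_iff.mp h1 with rfl | rfl
  · exact ⟨φ, hφ, fun x => by rw [hu, one_smul], fun x => by rw [hv, neg_smul, one_smul]⟩
  -- Passing to `φ̄` exchanges the two maps and hence the two eigenvalues.
  · refine ⟨φ.trans (conjEquiv r s), quatPolar_trans_conjEquiv hφ, fun x => ?_, fun x => ?_⟩
    · rw [hv, neg_neg, one_smul]
    · rw [trans_conjEquiv_trans_conjEquiv, hu, neg_smul, one_smul]

theorem pureWedge_act_kp {hV : finrank F V = 4} {h : LinearMap.BilinForm F V}
    {b : ⋀[F]^4 V ≃ₗ[F] F} {φ : V ≃ₗ[F] ℍ[F,r,s]} (hφ : IsAdapted hV h b φ) (x : ⋀[F]^2 V) :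
    pureWedge φ (act hV h b (kp h b) x) = pureWedge φ x := by
  have h2 : (2 : F) ≠ 0 := NeZero.ne _
  rw [act_kp, map_smul, map_add, hφ.1, ← two_smul F, smul_smul, inv_mul_cancel₀ h2, one_smul]

theorem pureWedge_conj_act_kp {hV : finrank F V = 4} {h : LinearMap.BilinForm F V}
    {b : ⋀[F]^4 V ≃ₗ[F] F} {φ : V ≃ₗ[F] ℍ[F,r,s]} (hφ : IsAdapted hV h b φ) (x : ⋀[F]^2 V) :
    pureWedge (φ.trans (conjEquiv r s)) (act hV h b (kp h b) x) = 0 := by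
  rw [act_kp, map_smul, map_add, hφ.2, add_neg_cancel, smul_zero]

theorem mem_Wsub_kp {hV : finrank F V = 4} {h : LinearMap.BilinForm F V}
    {b : ⋀[F]^4 V ≃ₗ[F] F} {φ : V ≃ₗ[F] ℍ[F,r,s]} {c : F} (hr : r ≠ 0) (hs : s ≠ 0)
    (hφ : ∀ x y, quatPolar r s (φ x) (φ y) = c * h x y) (ha : IsAdapted hV h b φ)
    {x : ⋀[F]^2 V} :
    x ∈ Wsub hV h b (kp h b) ↔ pureWedge (φ.trans (conjEquiv r s)) x = 0 := by
  constructor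
  · rintro ⟨y, rfl⟩
    exact pureWedge_conj_act_kp ha y
  · intro h0
    exact ⟨x, pureWedge_ext hV b hr hs hφ (pureWedge_act_kp ha x)
      (by rw [pureWedge_conj_act_kp ha, h0])⟩

theorem mem_Wsub_one_sub_kp {hV : finrank F V = 4} {h : LinearMap.BilinForm F V}
    {b : ⋀[F]^4 V ≃ₗ[F] F} {φ : V ≃ₗ[F] ℍ[F,r,s]} {c : F} (hr : r ≠ 0) (hs : s ≠ 0)
    (hφ : ∀ x y, quatPolar r s (φ x) (φ y) = c * h x y) (ha : IsAdapted hV h b φ)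
    {x : ⋀[F]^2 V} :
    x ∈ Wsub hV h b (1 - kp h b) ↔ pureWedge φ x = 0 := by
  constructor
  · rintro ⟨y, rfl⟩
    rw [act_one_sub_kp, map_sub, pureWedge_act_kp ha, sub_self]
  · intro h0
    refine ⟨x, pureWedge_ext hV b hr hs hφ ?_ ?_⟩
    · rw [act_one_sub_kp, map_sub, pureWedge_act_kp ha, sub_self, h0]
    · rw [act_one_sub_kp, map_sub, pureWedge_conj_act_kp ha, sub_zero]

theorem isCompl_Wsub {hV : finrank F V = 4} {h : LinearMap.BilinForm F V}
    {b : ⋀[F]^4 V ≃ₗ[F] F} {φ : V ≃ₗ[F] ℍ[F,r,s]} {c : F} (hr : r ≠ 0) (hs : s ≠ 0)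
    (hφ : ∀ x y, quatPolar r s (φ x) (φ y) = c * h x y) (ha : IsAdapted hV h b φ) :
    IsCompl (Wsub hV h b (kp h b)) (Wsub hV h b (1 - kp h b)) := by
  constructor
  · rw [Submodule.disjoint_def]
    intro x h1 h2
    rw [mem_Wsub_kp hr hs hφ ha] at h1
    rw [mem_Wsub_one_sub_kp hr hs hφ ha] at h2
    exact pureWedge_ext hV b hr hs hφ (by rw [h2, map_zero]) (by rw [h1, map_zero])
  · rw [codisjoint_iff, eq_top_iff]
    intro x _
    rw [Submodule.mem_sup]
    exact ⟨_, ⟨x, rfl⟩, _, ⟨x, rfl⟩, by rw [act_one_sub_kp, add_sub_cancel]⟩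

/-- The isomorphism of `W p` onto the space of pure quaternions. -/
def pureEquiv {hV : finrank F V = 4} {h : LinearMap.BilinForm F V}
    {b : ⋀[F]^4 V ≃ₗ[F] F} {φ : V ≃ₗ[F] ℍ[F,r,s]} {c : F} (hr : r ≠ 0) (hs : s ≠ 0)
    (hφ : ∀ x y, quatPolar r s (φ x) (φ y) = c * h x y) (ha : IsAdapted hV h b φ) :
    Wsub hV h b (kp h b) ≃ₗ[F] Pu r s :=
  LinearEquiv.ofBijective ((pureWedge φ).domRestrict (Wsub hV h b (kp h b)))
    ⟨fun x y hxy => Subtype.ext (pureWedge_ext hV b hr hs hφ hxy (by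
      rw [(mem_Wsub_kp hr hs hφ ha).mp x.2, (mem_Wsub_kp hr hs hφ ha).mp y.2])), fun u => by
      obtain ⟨w, hw, h0⟩ := exists_pureWedge_eq hV b hr hs hφ u 0
      exact ⟨⟨w, (mem_Wsub_kp hr hs hφ ha).mpr h0⟩, hw⟩⟩

theorem pureEquiv_apply {hV : finrank F V = 4} {h : LinearMap.BilinForm F V}
    {b : ⋀[F]^4 V ≃ₗ[F] F} {φ : V ≃ₗ[F] ℍ[F,r,s]} {c : F} (hr : r ≠ 0) (hs : s ≠ 0)
    (hφ : ∀ x y, quatPolar r s (φ x) (φ y) = c * h x y) (ha : IsAdapted hV h b φ)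
    (x : Wsub hV h b (kp h b)) : pureEquiv hr hs hφ ha x = pureWedge φ x := rfl

theorem isSimilitude_pureEquiv {hV : finrank F V = 4} {h : LinearMap.BilinForm F V}
    {b : ⋀[F]^4 V ≃ₗ[F] F} {φ : V ≃ₗ[F] ℍ[F,r,s]} {c : F} (hr : r ≠ 0) (hs : s ≠ 0) (hc : c ≠ 0)
    (hφ : ∀ x y, quatPolar r s (φ x) (φ y) = c * h x y) (ha : IsAdapted hV h b φ) :
    IsSimilitude (gCirc hV h b) (puPolar r s) (pureEquiv hr hs hφ ha) := by
  have h2 : (2 : F) ≠ 0 := NeZero.ne _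
  obtain ⟨κ, hκ, hP, hM⟩ := exists_puPolar_pureWedge hr hs b hφ
  refine ⟨4 * c ^ 2, mul_ne_zero ?_ (pow_ne_zero 2 hc), fun x y => ?_⟩
  · rw [show (4 : F) = 2 * 2 by norm_num]
    exact mul_ne_zero h2 h2
  · have hJ : hodge hV h b x = x := by
      have hx := (mem_Wsub_kp hr hs hφ ha).mp x.2
      exact pureWedge_ext hV b hr hs hφ (ha.1 _) (by rw [ha.2, hx, neg_zero])
    -- On `W p`, where `J = id`, the forms `Pf` and `⋀² h` agree, so `g°` is just `⋀² h`. The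
    -- companion map vanishes there, which gives `κ Pf = 2c² ⋀² h` and hence the multiplier `4c²`.
    have hpf : pf b (x : ⋀[F]^2 V) y = extForm 2 h x y := by
      rw [← pf_hodge hV h b (x : ⋀[F]^2 V) y, hJ]
    have h0 := hM x y
    rw [(mem_Wsub_kp hr hs hφ ha).mp x.2, map_zero, LinearMap.zero_apply] at h0
    rw [pureEquiv_apply, pureEquiv_apply, hP]
    simp only [gCirc, LinearMap.mk₂_apply, rMap, gForm, kMk, kMat, map_smul,
      LinearMap.smul_apply, smul_eq_mul, Matrix.of_apply, Matrix.cons_val_zero,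
      Matrix.cons_val_one, Matrix.cons_val', Matrix.cons_val_fin_one, hpf]
    rw [hpf] at h0
    field_simp
    linear_combination 4 * h0

end HodgeEigenspaces

/-! ### From split `K` to the norm form of a quaternion algebra. -/

section SplitForms

variable {F V : Type*} [Field F] [AddCommGroup V] [Module F V]

/-- A zero divisor `x + j y` has norm `x² - δ y² = 0` with `y ≠ 0`, so `δ = (x / y)²`. -/
theorem exists_sq_eq_delta {h : LinearMap.BilinForm F V} {b : ⋀[F]^4 V ≃ₗ[F] F}
    (hK : IsSplit h b) : ∃ q, delta h b = q ^ 2 := by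
  obtain ⟨⟨_, x, y, rfl⟩, ⟨_, x', y', rfl⟩, hx, hy, hxy⟩ := hK
  have hxy' := congrArg Subtype.val hxy
  have e1 := congrFun (congrFun hxy' 0) 0
  have e2 := congrFun (congrFun hxy' 1) 0
  simp [kMat] at e1 e2
  have hN : x ^ 2 - delta h b * y ^ 2 = 0 := by
    by_contra hN
    apply hy
    apply Subtype.ext
    have hx' : x' = 0 := by
      apply (mul_eq_zero.mp (_ : (x ^ 2 - delta h b * y ^ 2) * x' = 0)).resolve_left hN
      linear_combination x * e1 - delta h b * y * e2
    have hy' : y' = 0 := by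
      apply (mul_eq_zero.mp (_ : (x ^ 2 - delta h b * y ^ 2) * y' = 0)).resolve_left hN
      linear_combination x * e2 - y * e1
    ext i j
    fin_cases i <;> fin_cases j <;> simp [kMat, hx', hy']
  have hy0 : y ≠ 0 := by
    rintro rfl
    have hx0 : x = 0 := by simpa using hN
    apply hx
    apply Subtype.ext
    ext i j
    fin_cases i <;> fin_cases j <;> simp [kMat, hx0]
  refine ⟨x / y, ?_⟩
  field_simp
  linear_combination -hN

/-- The linear isomorphism of `F⁴` onto a quaternion algebra given by the basis `1, i, j, t k`. -/
def quatCoord (r s t : F) (ht : t ≠ 0) : (Fin 4 → F) ≃ₗ[F] ℍ[F,r,s] where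
  toFun v := ⟨v 0, v 1, v 2, t * v 3⟩
  invFun x := ![x.re, x.imI, x.imJ, t⁻¹ * x.imK]
  map_add' v w := by ext <;> simp [mul_add]
  map_smul' c v := by ext <;> simp [mul_left_comm]
  left_inv v := by ext i; fin_cases i <;> simp [ht]
  right_inv x := by ext <;> simp [ht]

variable [NeZero (2 : F)]

/-- A form in four variables whose discriminant is a square is similar to the norm form of a
quaternion algebra. -/
theorem exists_similitude_quatPolar (hV : finrank F V = 4) {h : LinearMap.BilinForm F V}
    (hsymm : h.IsSymm) (hnd : h.Nondegenerate) {b : ⋀[F]^4 V ≃ₗ[F] F} {q : F}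
    (hq : delta h b = q ^ 2) :
    ∃ r s : F, r ≠ 0 ∧ s ≠ 0 ∧ ∃ φ : V ≃ₗ[F] ℍ[F,r,s], IsSimilitude h (quatPolar r s) φ := by
  have h2 : (2 : F) ≠ 0 := NeZero.ne _
  have : FiniteDimensional F V := FiniteDimensional.of_finrank_pos (by omega)
  have : Invertible (2 : F) := invertibleOfNonzero h2
  obtain ⟨v', hv'⟩ := LinearMap.BilinForm.exists_orthogonal_basis (B := h)
    (LinearMap.isSymm_def.mpr hsymm.eq)
  let v := v'.reindex (finCongr hV)
  have ho : ∀ i j, i ≠ j → h (v i) (v j) = 0 := fun i j hij => by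
    simp only [v, Basis.reindex_apply]
    exact hv' fun hh => hij ((finCongr hV).symm.injective hh)
  have hd : ∀ i, h (v i) (v i) ≠ 0 := fun i => by
    simp only [v, Basis.reindex_apply]
    exact hv'.not_isOrtho_basis_self_of_separatingLeft hnd.1 _
  have hgram : h (v 0) (v 0) * h (v 1) (v 1) * h (v 2) (v 2) * h (v 3) (v 3) =
      (b (exteriorPower.ιMulti F 4 v) * q) ^ 2 := by
    rw [mul_pow, ← hq, ← gram_det_eq]
    have : (Matrix.of fun i j => h (v i) (v j)) = Matrix.diagonal fun i => h (v i) (v i) := by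
      ext i j
      by_cases hij : i = j
      · subst hij; simp
      · simp [hij, ho i j hij]
    rw [this, Matrix.det_diagonal, Fin.prod_univ_four]
  have hsum : ∀ x y, h x y = ∑ i, h (v i) (v i) * (v.equivFun x i * v.equivFun y i) := by
    intro x y
    conv_lhs => rw [← v.sum_equivFun x, ← v.sum_equivFun y]
    simp only [map_sum, LinearMap.sum_apply, map_smul, LinearMap.smul_apply, smul_eq_mul]
    refine Finset.sum_congr rfl fun i _ => ?_
    rw [Finset.sum_eq_single i]
    · ring
    · intro j _ hj
      rw [ho j i hj]; ring
    · simp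
  generalize b (exteriorPower.ιMulti F 4 v) * q = g at hgram
  have h0 := hd 0
  have h1 := hd 1
  have h3 := hd 2
  have h4 := hd 3
  simp only [Fin.sum_univ_four] at hsum
  generalize h (v 0) (v 0) = a₀ at *
  generalize h (v 1) (v 1) = a₁ at *
  generalize h (v 2) (v 2) = a₂ at *
  generalize h (v 3) (v 3) = a₃ at *
  have hg : g ≠ 0 := by
    rintro rfl
    simp [h0, h1, h3, h4] at hgram
  -- With `r = -a₁/a₀` and `s = -a₂/a₀`, the first three coefficients of `N` match those of `h /
  -- a₀`. The fourth requires `r s t² = a₃/a₀`, which `t = g / (a₁ a₂)` solves because `a₀ a₁ a₂ a₃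
  -- = g²`.
  have ht : g / (a₁ * a₂) ≠ 0 := div_ne_zero hg (mul_ne_zero h1 h3)
  refine ⟨-(a₁ / a₀), -(a₂ / a₀), neg_ne_zero.mpr (div_ne_zero h1 h0),
    neg_ne_zero.mpr (div_ne_zero h3 h0), v.equivFun.trans (quatCoord _ _ _ ht),
    2 / a₀, div_ne_zero h2 h0, fun x y => ?_⟩
  rw [hsum, quatPolar_eq]
  simp only [LinearEquiv.trans_apply]
  generalize v.equivFun x = X
  generalize v.equivFun y = Y
  simp only [quatCoord, LinearEquiv.coe_mk, LinearMap.coe_mk, AddHom.coe_mk]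
  field_simp
  linear_combination -(X 3 * Y 3) * hgram

end SplitForms

/-! ### Proper similitudes and their action on the two summands. -/

section ProperSimilitudes

variable {F : Type*} [Field F] {r s : F} {V : Type*} [AddCommGroup V] [Module F V]

theorem form_apply_of_transport_eq_mulLR {h : LinearMap.BilinForm F V} {φ : V ≃ₗ[F] ℍ[F,r,s]}
    {c : F} (hc : c ≠ 0) (hφ : ∀ x y, quatPolar r s (φ x) (φ y) = c * h x y) {l : V ≃ₗ[F] V}
    {a d : (ℍ[F,r,s])ˣ} (hl : transport φ l = mulLR a d) (x y : V) :
    h (l x) (l y) = quatNorm r s a * quatNorm r s d * h x y := by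
  apply mul_left_cancel₀ hc
  rw [← hφ, ← transport_apply_apply, ← transport_apply_apply, hl, quatPolar_mulLR, hφ]
  ring

theorem quatNorm_star_mul_star (a d : (ℍ[F,r,s])ˣ) :
    quatNorm r s (star d : (ℍ[F,r,s])ˣ) * quatNorm r s (star a : (ℍ[F,r,s])ˣ) =
      quatNorm r s a * quatNorm r s d := by
  rw [Units.coe_star, Units.coe_star, quatNorm_star, quatNorm_star, mul_comm]

/-- `⋀⁴ l` is multiplication by `det l`, so determinants can be read off from the Pfaffian form. -/
theorem det_eq_of_pf {hV : finrank F V = 4} {b : ⋀[F]^4 V ≃ₗ[F] F} {l : V ≃ₗ[F] V} {t : F}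
    (hl : ∀ x y, pf b (exteriorPower.map 2 (l : V →ₗ[F] V) x)
      (exteriorPower.map 2 (l : V →ₗ[F] V) y) = t * pf b x y) :
    LinearMap.det (l : V →ₗ[F] V) = t := by
  have : FiniteDimensional F V := FiniteDimensional.of_finrank_pos (by omega)
  have hne : ∃ x y, pf b x y ≠ 0 := by
    by_contra! h0
    have h1 : finrank F (⋀[F]^2 V) = 6 := by rw [exteriorPower.finrank_eq, hV]; rfl
    have : Nontrivial (⋀[F]^2 V) := Module.nontrivial_of_finrank_pos (R := F) (by omega)
    obtain ⟨x, hx⟩ := exists_ne (0 : ⋀[F]^2 V)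
    apply hx
    apply pf_injective hV b
    refine LinearMap.ext fun y => ?_
    rw [h0, map_zero, LinearMap.zero_apply]
  obtain ⟨x, y, hxy⟩ := hne
  apply mul_right_cancel₀ hxy
  rw [← hl, pf_apply, pf_apply, ← map_wedge, map_four hV]

theorem transport_mem_GO {h : LinearMap.BilinForm F V} {φ : V ≃ₗ[F] ℍ[F,r,s]} {c : F}
    (hφ : ∀ x y, quatPolar r s (φ x) (φ y) = c * h x y) {l : V ≃ₗ[F] V} {t : F} (ht : t ≠ 0)
    (hl : ∀ x y, h (l x) (l y) = t * h x y) : transport φ l ∈ GO (quatPolar r s) := by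
  refine ⟨t, ht, fun x y => ?_⟩
  obtain ⟨x, rfl⟩ := φ.surjective x
  obtain ⟨y, rfl⟩ := φ.surjective y
  rw [transport_apply_apply, transport_apply_apply, hφ, hl, hφ]
  ring

variable [NeZero (2 : F)]

theorem puPolar_smul_puConj (hr : r ≠ 0) (hs : s ≠ 0) (a : (ℍ[F,r,s])ˣ) (t : F) (x y : Pu r s) :
    puPolar r s (t • puConj a x) (t • puConj a y) = t ^ 2 * puPolar r s x y := by
  simp only [map_smul, LinearMap.smul_apply, smul_eq_mul, (puConj_mem_SO hr hs a).1]
  ring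

theorem det_of_transport_eq_mulLR (hV : finrank F V = 4) {h : LinearMap.BilinForm F V}
    (b : ⋀[F]^4 V ≃ₗ[F] F) {φ : V ≃ₗ[F] ℍ[F,r,s]} {c : F} (hr : r ≠ 0) (hs : s ≠ 0)
    (hφ : ∀ x y, quatPolar r s (φ x) (φ y) = c * h x y) {l : V ≃ₗ[F] V}
    {a d : (ℍ[F,r,s])ˣ} (hl : transport φ l = mulLR a d) :
    LinearMap.det (l : V →ₗ[F] V) = (quatNorm r s a * quatNorm r s d) ^ 2 := by
  have h2 : (2 : F) ≠ 0 := NeZero.ne _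
  obtain ⟨κ, hκ, hP, hM⟩ := exists_puPolar_pureWedge hr hs b hφ
  refine det_eq_of_pf (hV := hV) (b := b) fun x y => ?_
  have hu : l.trans φ = φ.trans (mulLR a d) := by rw [trans_transport, hl]
  -- The involution turns `x ↦ a x d` into `x ↦ (star d) x (star a)`; both components are thus
  -- scaled by the same norm, and so is the difference `2κ Pf`.
  have hv : l.trans (φ.trans (conjEquiv r s)) =
      (φ.trans (conjEquiv r s)).trans (mulLR (star d) (star a)) := by
    ext1 z
    exact (congrArg (conjEquiv r s) (LinearEquiv.congr_fun hu z)).trans (conjEquiv_mulLR a d _)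
  have e1 := hP (exteriorPower.map 2 (l : V →ₗ[F] V) x) (exteriorPower.map 2 (l : V →ₗ[F] V) y)
  have e2 := hM (exteriorPower.map 2 (l : V →ₗ[F] V) x) (exteriorPower.map 2 (l : V →ₗ[F] V) y)
  rw [pureWedge_map, pureWedge_map, hu, pureWedge_trans_mulLR, pureWedge_trans_mulLR,
    puPolar_smul_puConj hr hs, hP] at e1
  rw [pureWedge_map, pureWedge_map, hv, pureWedge_trans_mulLR, pureWedge_trans_mulLR,
    puPolar_smul_puConj hr hs, quatNorm_star_mul_star, hM] at e2
  apply mul_left_cancel₀ (mul_ne_zero h2 hκ)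
  linear_combination e2 - e1

theorem det_of_transport_eq_mulLR_mul_conj (hV : finrank F V = 4) {h : LinearMap.BilinForm F V}
    (b : ⋀[F]^4 V ≃ₗ[F] F) {φ : V ≃ₗ[F] ℍ[F,r,s]} {c : F} (hr : r ≠ 0) (hs : s ≠ 0)
    (hφ : ∀ x y, quatPolar r s (φ x) (φ y) = c * h x y) {l : V ≃ₗ[F] V}
    {a d : (ℍ[F,r,s])ˣ} (hl : transport φ l = mulLR a d * conjEquiv r s) :
    LinearMap.det (l : V →ₗ[F] V) = -(quatNorm r s a * quatNorm r s d) ^ 2 := by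
  have h2 : (2 : F) ≠ 0 := NeZero.ne _
  obtain ⟨κ, hκ, hP, hM⟩ := exists_puPolar_pureWedge hr hs b hφ
  refine det_eq_of_pf (hV := hV) (b := b) fun x y => ?_
  have hu : l.trans φ = (φ.trans (conjEquiv r s)).trans (mulLR a d) := by
    rw [trans_transport, hl]; rfl
  -- Now the two components are also exchanged, which reverses the sign of `2κ Pf`.
  have hv : l.trans (φ.trans (conjEquiv r s)) = φ.trans (mulLR (star d) (star a)) := by
    ext1 z
    refine (congrArg (conjEquiv r s) (LinearEquiv.congr_fun hu z)).trans
      ((conjEquiv_mulLR a d _).trans ?_)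
    exact congrArg (mulLR (star d) (star a)) (star_star (φ z))
  have e1 := hP (exteriorPower.map 2 (l : V →ₗ[F] V) x) (exteriorPower.map 2 (l : V →ₗ[F] V) y)
  have e2 := hM (exteriorPower.map 2 (l : V →ₗ[F] V) x) (exteriorPower.map 2 (l : V →ₗ[F] V) y)
  rw [pureWedge_map, pureWedge_map, hu, pureWedge_trans_mulLR, pureWedge_trans_mulLR,
    puPolar_smul_puConj hr hs, hM] at e1
  rw [pureWedge_map, pureWedge_map, hv, pureWedge_trans_mulLR, pureWedge_trans_mulLR,
    puPolar_smul_puConj hr hs, quatNorm_star_mul_star, hP] at e2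
  apply mul_left_cancel₀ (mul_ne_zero h2 hκ)
  linear_combination e2 - e1

theorem mem_GOplus_of_transport_eq_mulLR (hV : finrank F V = 4) {h : LinearMap.BilinForm F V}
    (b : ⋀[F]^4 V ≃ₗ[F] F) {φ : V ≃ₗ[F] ℍ[F,r,s]} {c : F} (hr : r ≠ 0) (hs : s ≠ 0) (hc : c ≠ 0)
    (hφ : ∀ x y, quatPolar r s (φ x) (φ y) = c * h x y) {l : V ≃ₗ[F] V}
    {a d : (ℍ[F,r,s])ˣ} (hl : transport φ l = mulLR a d) : l ∈ GOplus h :=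
  ⟨_, mul_ne_zero (quatNorm_unit_ne_zero a) (quatNorm_unit_ne_zero d),
    form_apply_of_transport_eq_mulLR hc hφ hl, det_of_transport_eq_mulLR hV b hr hs hφ hl⟩

theorem mem_SO_of_transport_eq_mulLR (hV : finrank F V = 4) {h : LinearMap.BilinForm F V}
    (b : ⋀[F]^4 V ≃ₗ[F] F) {φ : V ≃ₗ[F] ℍ[F,r,s]} {c : F} (hr : r ≠ 0) (hs : s ≠ 0) (hc : c ≠ 0)
    (hφ : ∀ x y, quatPolar r s (φ x) (φ y) = c * h x y) {l : V ≃ₗ[F] V}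
    {a d : (ℍ[F,r,s])ˣ} (hl : transport φ l = mulLR a d)
    (hN : quatNorm r s a * quatNorm r s d = 1) : l ∈ SO h := by
  refine ⟨fun x y => ?_, Units.ext ?_⟩
  · rw [form_apply_of_transport_eq_mulLR hc hφ hl, hN, one_mul]
  · rw [LinearEquiv.coe_det, det_of_transport_eq_mulLR hV b hr hs hφ hl, hN, one_pow,
      Units.val_one]

/-- The multiplier of a similitude is determined by its action on the norm of `1`. -/
theorem quatNorm_transport_one {h : LinearMap.BilinForm F V} {φ : V ≃ₗ[F] ℍ[F,r,s]} {c : F}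
    (hφ : ∀ x y, quatPolar r s (φ x) (φ y) = c * h x y) {l : V ≃ₗ[F] V} {t : F}
    (hl : ∀ x y, h (l x) (l y) = t * h x y) : quatNorm r s (transport φ l 1) = t := by
  have h2 : (2 : F) ≠ 0 := NeZero.ne _
  obtain ⟨x, hx⟩ := φ.surjective 1
  have h1 := hφ (l x) (l x)
  have h3 := hφ x x
  rw [hl] at h1
  rw [hx, quatPolar_self, quatNorm_one] at h3
  rw [← transport_apply_apply, hx, quatPolar_self] at h1
  apply mul_left_cancel₀ h2
  linear_combination h1 - t * h3

theorem exists_transport_eq_mulLR (hV : finrank F V = 4) {h : LinearMap.BilinForm F V}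
    (b : ⋀[F]^4 V ≃ₗ[F] F) {φ : V ≃ₗ[F] ℍ[F,r,s]} {c : F} (hr : r ≠ 0) (hs : s ≠ 0)
    (hφ : ∀ x y, quatPolar r s (φ x) (φ y) = c * h x y) {l : V ≃ₗ[F] V} (hl : l ∈ GOplus h) :
    ∃ a d : (ℍ[F,r,s])ˣ, transport φ l = mulLR a d := by
  have h2 : (2 : F) ≠ 0 := NeZero.ne _
  obtain ⟨t, ht, hl, hdet⟩ := hl
  obtain ⟨a, d, had | had⟩ := similitude_eq hr hs (transport_mem_GO hφ ht hl)
  · exact ⟨a, d, had⟩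
  · exfalso
    have h1 := det_of_transport_eq_mulLR_mul_conj hV b hr hs hφ had
    have h3 := quatNorm_transport_one hφ hl
    rw [had] at h3
    have h4 : (mulLR a d * conjEquiv r s) 1 = (a : ℍ[F,r,s]) * d := by
      simp [mulLR, conjEquiv]
    rw [h4, quatNorm_mul] at h3
    rw [hdet, h3] at h1
    -- An improper similitude has determinant `-t²`, which differs from `t²` since `2 ≠ 0`.
    have : 2 * t ^ 2 = 0 := by linear_combination h1
    simp [h2, ht] at this

theorem eta_pureEquiv {hV : finrank F V = 4} {h : LinearMap.BilinForm F V}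
    {b : ⋀[F]^4 V ≃ₗ[F] F} {φ : V ≃ₗ[F] ℍ[F,r,s]} {c : F} (hr : r ≠ 0) (hs : s ≠ 0)
    (hφ : ∀ x y, quatPolar r s (φ x) (φ y) = c * h x y) (ha : IsAdapted hV h b φ)
    {l : GOplus h} {a d : (ℍ[F,r,s])ˣ} (hl : transport φ (l : V ≃ₗ[F] V) = mulLR a d)
    (x : Pu r s) :
    (transport (pureEquiv hr hs hφ ha)).toMonoidHom.comp (eta hV h b (kp h b)) l x =
      (quatNorm r s a * quatNorm r s d) • puConj a x := by
  obtain ⟨w, rfl⟩ := (pureEquiv hr hs hφ ha).surjective x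
  change transport (pureEquiv hr hs hφ ha) (eta hV h b (kp h b) l) (pureEquiv hr hs hφ ha w) = _
  rw [transport_apply_apply, pureEquiv_apply, pureEquiv_apply]
  change pureWedge φ (exteriorPower.map 2 (l.1 : V →ₗ[F] V) w.1) = _
  rw [pureWedge_map, trans_transport, hl, pureWedge_trans_mulLR]

theorem eta_quasiEquivalent {hV : finrank F V = 4} {h : LinearMap.BilinForm F V}
    {b : ⋀[F]^4 V ≃ₗ[F] F} {φ : V ≃ₗ[F] ℍ[F,r,s]} {c : F} (hr : r ≠ 0) (hs : s ≠ 0) (hc : c ≠ 0)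
    (hφ : ∀ x y, quatPolar r s (φ x) (φ y) = c * h x y) (ha : IsAdapted hV h b φ) :
    QuasiEquivalent (eta hV h b (1 - kp h b))
      ((transport (pureEquiv hr hs hφ ha)).toMonoidHom.comp (eta hV h b (kp h b))) := by
  -- The involution read on `V`: conjugation by it is the automorphism `θ`, and `⋀² σ` exchanges `W
  -- p` and `W (1 - p)`.
  let σ : V ≃ₗ[F] V := (transport φ).symm (conjEquiv r s)
  have hσφ : σ.trans φ = φ.trans (conjEquiv r s) := by
    rw [trans_transport, MulEquiv.apply_symm_apply]
  have hσσ : ∀ x, σ (σ x) = x := fun x => by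
    change φ.symm (star (φ (φ.symm (star (φ x))))) = x
    simp
  have hσ : ∀ x y, h (σ x) (σ y) = h x y := fun x y => by
    apply mul_left_cancel₀ hc
    rw [← hφ, ← hφ]
    change quatPolar r s ((σ.trans φ) x) ((σ.trans φ) y) = _
    rw [hσφ]
    exact quatPolar_star_star _ _
  have hmem : ∀ l ∈ GOplus h, σ * l * σ ∈ GOplus h := by
    rintro l ⟨t, ht, hl, hdet⟩
    refine ⟨t, ht, fun x y => by simp [hσ, hl], ?_⟩
    have h1 : LinearMap.det (σ : V →ₗ[F] V) * LinearMap.det (σ : V →ₗ[F] V) = 1 := by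
      rw [← LinearMap.det_comp, ← LinearMap.det_id (A := F) (M := V)]
      congr 1
      ext1 x
      exact hσσ x
    have h2 : ((σ * l * σ : V ≃ₗ[F] V) : V →ₗ[F] V) =
        (σ : V →ₗ[F] V) ∘ₗ (l : V →ₗ[F] V) ∘ₗ (σ : V →ₗ[F] V) := rfl
    rw [h2, LinearMap.det_comp, LinearMap.det_comp, hdet]
    linear_combination t ^ 2 * h1
  have hss : σ * σ = 1 := LinearEquiv.ext hσσ
  let θ : GOplus h ≃* GOplus h :=
    { toFun := fun l => ⟨σ * l * σ, hmem l l.2⟩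
      invFun := fun l => ⟨σ * l * σ, hmem l l.2⟩
      left_inv := fun l => Subtype.ext (LinearEquiv.ext fun x => by simp [hσσ])
      right_inv := fun l => Subtype.ext (LinearEquiv.ext fun x => by simp [hσσ])
      map_mul' := fun l m => Subtype.ext (LinearEquiv.ext fun x => by simp [hσσ]) }
  have hφ' : σ.trans (φ.trans (conjEquiv r s)) = φ := by
    ext1 x
    have := LinearEquiv.congr_fun hσφ x
    change star (φ (σ x)) = φ x
    change φ (σ x) = star (φ x) at this
    rw [this, star_star]
  have hto : ∀ w ∈ Wsub hV h b (1 - kp h b),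
      exteriorPower.map 2 (σ : V →ₗ[F] V) w ∈ Wsub hV h b (kp h b) := fun w hw => by
    rw [mem_Wsub_kp hr hs hφ ha, pureWedge_map, hφ']
    exact (mem_Wsub_one_sub_kp hr hs hφ ha).mp hw
  have hfrom : ∀ w ∈ Wsub hV h b (kp h b),
      exteriorPower.map 2 (σ : V →ₗ[F] V) w ∈ Wsub hV h b (1 - kp h b) := fun w hw => by
    rw [mem_Wsub_one_sub_kp hr hs hφ ha, pureWedge_map, hσφ]
    exact (mem_Wsub_kp hr hs hφ ha).mp hw
  have hmap : ∀ w, exteriorPower.map 2 (σ : V →ₗ[F] V)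
      (exteriorPower.map 2 (σ : V →ₗ[F] V) w) = w := fun w => by
    rw [← map_mul_apply, hss, map_one_apply]
  let S : Wsub hV h b (1 - kp h b) ≃ₗ[F] Wsub hV h b (kp h b) :=
    { toFun := fun w => ⟨_, hto w w.2⟩
      invFun := fun w => ⟨_, hfrom w w.2⟩
      map_add' := fun x y => Subtype.ext (map_add _ _ _)
      map_smul' := fun t x => Subtype.ext (map_smul _ _ _)
      left_inv := fun w => Subtype.ext (hmap w)
      right_inv := fun w => Subtype.ext (hmap w) }
  refine ⟨θ, S.trans (pureEquiv hr hs hφ ha), fun l w => ?_⟩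
  change pureEquiv hr hs hφ ha (S (eta hV h b (1 - kp h b) l w)) =
    transport (pureEquiv hr hs hφ ha) (eta hV h b (kp h b) (θ l)) (pureEquiv hr hs hφ ha (S w))
  rw [transport_apply_apply]
  congr 1
  apply Subtype.ext
  change exteriorPower.map 2 (σ : V →ₗ[F] V) (exteriorPower.map 2 (l.1 : V →ₗ[F] V) w.1) =
    exteriorPower.map 2 ((σ * l.1 * σ : V ≃ₗ[F] V) : V →ₗ[F] V)
      (exteriorPower.map 2 (σ : V →ₗ[F] V) w.1)
  rw [map_mul_apply, hmap, map_mul_apply]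

theorem range_eta {hV : finrank F V = 4} {h : LinearMap.BilinForm F V}
    {b : ⋀[F]^4 V ≃ₗ[F] F} {φ : V ≃ₗ[F] ℍ[F,r,s]} {c : F} (hr : r ≠ 0) (hs : s ≠ 0) (hc : c ≠ 0)
    (hφ : ∀ x y, quatPolar r s (φ x) (φ y) = c * h x y) (ha : IsAdapted hV h b φ) :
    (((transport (pureEquiv hr hs hφ ha)).toMonoidHom.comp (eta hV h b (kp h b))).range :
        Set (Pu r s ≃ₗ[F] Pu r s)) =
      {m | ∃ u : (ℍ[F,r,s])ˣ, ∃ t ∈ SO (puPolar r s),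
        ∀ x, m x = quatNorm r s (u : ℍ[F,r,s]) • t x} := by
  ext m
  constructor
  · rintro ⟨l, rfl⟩
    obtain ⟨a, d, had⟩ := exists_transport_eq_mulLR hV b hr hs hφ l.2
    refine ⟨a * d, puConj a, puConj_mem_SO hr hs a, fun x => ?_⟩
    rw [eta_pureEquiv hr hs hφ ha had, Units.val_mul, quatNorm_mul]
  · rintro ⟨u, t, ht, hm⟩
    obtain ⟨a, rfl⟩ := exists_puConj hr hs ht
    -- The right factor `a⁻¹ u` leaves the rotation unchanged and adjusts the scalar to `N a * N
    -- (a⁻¹ u) = N u`.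
    have hl : transport φ ((transport φ).symm (mulLR a (a⁻¹ * u))) = mulLR a (a⁻¹ * u) :=
      MulEquiv.apply_symm_apply _ _
    refine ⟨⟨_, mem_GOplus_of_transport_eq_mulLR hV b hr hs hc hφ hl⟩,
      LinearEquiv.ext fun x => ?_⟩
    rw [eta_pureEquiv hr hs hφ ha hl, hm, Units.val_mul, quatNorm_mul, ← mul_assoc,
      quatNorm_unit_mul_inv, one_mul]

/-- For an isometry the multiplier `N a * N d` is `1`, so only the conjugation remains; `x ↦ a x
a⁻¹` lifts any rotation. -/
theorem map_SO_eta {hV : finrank F V = 4} {h : LinearMap.BilinForm F V}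
    {b : ⋀[F]^4 V ≃ₗ[F] F} {φ : V ≃ₗ[F] ℍ[F,r,s]} {c : F} (hr : r ≠ 0) (hs : s ≠ 0) (hc : c ≠ 0)
    (hφ : ∀ x y, quatPolar r s (φ x) (φ y) = c * h x y) (ha : IsAdapted hV h b φ) :
    ((SO h).subgroupOf (GOplus h)).map
        ((transport (pureEquiv hr hs hφ ha)).toMonoidHom.comp (eta hV h b (kp h b))) =
      SO (puPolar r s) := by
  ext m
  constructor
  · rintro ⟨l, hl, rfl⟩
    obtain ⟨a, d, had⟩ := exists_transport_eq_mulLR hV b hr hs hφ l.2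
    have hN := quatNorm_transport_one hφ (l := l.1) (t := 1) fun x y => by
      rw [one_mul]; exact hl.1 x y
    have hm : mulLR a d 1 = (a : ℍ[F,r,s]) * d := by simp [mulLR]
    rw [had, hm, quatNorm_mul] at hN
    have : (transport (pureEquiv hr hs hφ ha)).toMonoidHom.comp (eta hV h b (kp h b)) l =
        puConj a := LinearEquiv.ext fun x => by
      rw [eta_pureEquiv hr hs hφ ha had, hN, one_smul]
    rw [this]
    exact puConj_mem_SO hr hs a
  · intro ht
    obtain ⟨a, rfl⟩ := exists_puConj hr hs ht
    have hl : transport φ ((transport φ).symm (mulLR a a⁻¹)) = mulLR a a⁻¹ :=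
      MulEquiv.apply_symm_apply _ _
    refine ⟨⟨_, mem_GOplus_of_transport_eq_mulLR hV b hr hs hc hφ hl⟩,
      mem_SO_of_transport_eq_mulLR hV b hr hs hc hφ hl (quatNorm_unit_mul_inv a),
      LinearEquiv.ext fun x => ?_⟩
    rw [eta_pureEquiv hr hs hφ ha hl, quatNorm_unit_mul_inv, one_smul]

end ProperSimilitudes

end Hodge

end

/-! ### The main theorem. -/

theorem mainTheorem4 {F V : Type*} [Field F] [NeZero (2 : F)] [AddCommGroup V] [Module F V]
    (hV : Module.finrank F V = 4)
    (h : LinearMap.BilinForm F V) (hsymm : h.IsSymm) (hnd : h.Nondegenerate)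
    (b : ⋀[F]^4 V ≃ₗ[F] F) (hK : Hodge.IsSplit h b) :
    -- `b` can be normalized
    (∃ b₀ : ⋀[F]^4 V ≃ₗ[F] F, Hodge.IsNormalized hV h b₀) ∧
    -- the quaternion algebra `H = ℍ[F,r,s]`
    ∃ r s : F, r ≠ 0 ∧ s ≠ 0 ∧
      -- `h` is similar to `f_N`
      (∃ φ : V ≃ₗ[F] ℍ[F,r,s], Hodge.IsSimilitude h (Hodge.quatPolar r s) φ) ∧
      -- the group of similitudes of `f_N`
      Hodge.GO (Hodge.quatPolar r s) = Subgroup.closure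
        ({Hodge.conjEquiv r s} ∪ {m | ∃ a : (ℍ[F,r,s])ˣ, m = Hodge.mulLR a 1} ∪
          {m | ∃ c : (ℍ[F,r,s])ˣ, m = Hodge.mulLR 1 c}) ∧
      ∀ b₀ : ⋀[F]^4 V ≃ₗ[F] F, Hodge.IsNormalized hV h b₀ →
        -- `W = W p ⊕ W (1 - p)`
        IsCompl (Hodge.Wsub hV h b₀ (Hodge.kp h b₀)) (Hodge.Wsub hV h b₀ (1 - Hodge.kp h b₀)) ∧
        -- `g°` on `W p` is similar to `f_N` on `Pu H`
        ∃ Θ : Hodge.Wsub hV h b₀ (Hodge.kp h b₀) ≃ₗ[F] Hodge.Pu r s,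
          Hodge.IsSimilitude (Hodge.gCirc hV h b₀) (Hodge.puPolar r s) Θ ∧
          -- `ρ` is `η°`, read on `Pu H` via `Θ`
          ∃ ρ : Hodge.GOplus h →* (Hodge.Pu r s ≃ₗ[F] Hodge.Pu r s),
            ρ = (Hodge.transport Θ).toMonoidHom.comp (Hodge.eta hV h b₀ (Hodge.kp h b₀)) ∧
            (∃ φ : V ≃ₗ[F] ℍ[F,r,s], Hodge.IsSimilitude h (Hodge.quatPolar r s) φ ∧
              ∀ a c : (ℍ[F,r,s])ˣ, ∃ l : Hodge.GOplus h,
                Hodge.transport φ (l : V ≃ₗ[F] V) = Hodge.mulLR a c ∧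
                ∀ x : Hodge.Pu r s, (ρ l x : ℍ[F,r,s]) =
                  (Hodge.quatNorm r s (a : ℍ[F,r,s]) * Hodge.quatNorm r s (c : ℍ[F,r,s])) •
                    ((a : ℍ[F,r,s]) * (x : ℍ[F,r,s]) * ((a⁻¹ : (ℍ[F,r,s])ˣ) : ℍ[F,r,s]))) ∧
            Hodge.QuasiEquivalent (Hodge.eta hV h b₀ (1 - Hodge.kp h b₀)) ρ ∧
            -- the images of the groups of proper similitudes and of special isometries
            (ρ.range : Set (Hodge.Pu r s ≃ₗ[F] Hodge.Pu r s)) =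
              {m | ∃ u : (ℍ[F,r,s])ˣ, ∃ t ∈ Hodge.SO (Hodge.puPolar r s),
                ∀ x, m x = Hodge.quatNorm r s (u : ℍ[F,r,s]) • t x} ∧
            ((Hodge.SO h).subgroupOf (Hodge.GOplus h)).map ρ = Hodge.SO (Hodge.puPolar r s) := by
  obtain ⟨q, hq⟩ := Hodge.exists_sq_eq_delta hK
  obtain ⟨r, s, hr, hs, φ₀, c, hc, hφ₀⟩ := Hodge.exists_similitude_quatPolar hV hsymm hnd hq
  refine ⟨Hodge.exists_isNormalized hV b hr hs hc hφ₀, r, s, hr, hs, ⟨φ₀, c, hc, hφ₀⟩,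
    Hodge.GO_quatPolar hr hs, fun b₀ hb₀ => ?_⟩
  -- The algebra `H` is fixed before `b₀`; only the similitude is adjusted to it.
  obtain ⟨φ, hφ, ha⟩ := Hodge.exists_isAdapted hV hr hs hc hφ₀ hb₀
  refine ⟨Hodge.isCompl_Wsub hr hs hφ ha, Hodge.pureEquiv hr hs hφ ha,
    Hodge.isSimilitude_pureEquiv hr hs hc hφ ha, _, rfl, ⟨φ, ⟨c, hc, hφ⟩, fun a d => ?_⟩,
    Hodge.eta_quasiEquivalent hr hs hc hφ ha, Hodge.range_eta hr hs hc hφ ha,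
    Hodge.map_SO_eta hr hs hc hφ ha⟩
  have hl : Hodge.transport φ ((Hodge.transport φ).symm (Hodge.mulLR a d)) = Hodge.mulLR a d :=
    MulEquiv.apply_symm_apply _ _
  refine ⟨⟨_, Hodge.mem_GOplus_of_transport_eq_mulLR hV b₀ hr hs hc hφ hl⟩, hl, fun x => ?_⟩
  rw [Hodge.eta_pureEquiv hr hs hφ ha hl]
  rfl
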